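/- Let $n\in\mathbb{N}$, $n\ge 1$, set $N=2^{\lfloor (n+1)/2\rfloor}$, and let $\alpha_1,\dots,\alpha_n,\alpha_{n+1}=\beta\in\mathbb{C}^{N\times N}$ be Hermitian matrices with $\alpha_j\alpha_k+\alpha_k\alpha_j=2\delta_{j,k}I_N$ for $1\le j,k\le n+1$. Let $$H_0=\alpha\cdot(-i\nabla)=\sum_{j=1}^n\alpha_j(-i\partial_j),\qquad \mathrm{dom}(H_0)=[W^{1,2}(\mathbb{R}^n)]^N,$$ be the free massless Dirac operator in $[L^2(\mathbb{R}^n)]^N=L^2(\mathbb{R}^n;\mathbb{C}^N)$. Let $V=\{V_{\ell,m}\}_{1\le\ell,m\le N}\in[L^\infty(\mathbb{R}^n)]^{N\times N}$ (not necessarily self-adjoint) satisfy, for some $C\in(0,\infty)$ and $\rho\in(n,\infty)$, $$|V_{\ell,m}(x)|\le C\langle x\rangle^{-\rho}\quad\text{for a.e. }x\in\mathbb{R}^n,\ 1\le\ell,m\le N,\qquad \langle x\rangle=(1+|x|^2)^{1/2},$$ and let $H=H_0+V$ with $\mathrm{dom}(H)=\mathrm{dom}(H_0)$. Let $k\in\mathbb{N}$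 with $k\ge n$ and let $z\in\mathbb{C}\setminus\mathbb{R}$. Then $z$ belongs to the resolvent set $\rho(H_0)$ of $H_0$; if $V(x)$ is Hermitian for a.e. $x$, then $z$ also belongs to the resolvent set $\rho(H)$ of $H$; and whenever $z\in\rho(H)$, the operator $$(H-z)^{-k}-(H_0-z)^{-k}$$ is trace class on $[L^2(\mathbb{R}^n)]^N$. -/

import Mathlib

open MeasureTheory
open scoped ENNReal SchwartzMap LineDeriv

/-- `[L²(ℝⁿ)]^N = L²(ℝⁿ; ℂ^N)`. -/
abbrev SpinorL2 (n N : ℕ) : Type :=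
  Lp (EuclideanSpace ℂ (Fin N)) 2 (volume : Measure (EuclideanSpace ℝ (Fin n)))

/-- `g` is the weak (distributional) partial derivative `∂_j f` of the `L²`-function `f`. -/
def HasWeakPartial {n N : ℕ} (j : Fin n) (f g : SpinorL2 n N) : Prop :=
  ∂_{EuclideanSpace.single j (1 : ℝ)}
    (f : 𝓢'(EuclideanSpace ℝ (Fin n), EuclideanSpace ℂ (Fin N))) =
    (g : 𝓢'(EuclideanSpace ℝ (Fin n), EuclideanSpace ℂ (Fin N)))

theorem spinor_toTempered_add {n N : ℕ} (f g : SpinorL2 n N) :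
    ((f + g : SpinorL2 n N) : 𝓢'(EuclideanSpace ℝ (Fin n), EuclideanSpace ℂ (Fin N))) =
      (f : 𝓢'(EuclideanSpace ℝ (Fin n), EuclideanSpace ℂ (Fin N))) + g :=
  map_add (Lp.toTemperedDistributionCLM (EuclideanSpace ℂ (Fin N))
    (volume : Measure (EuclideanSpace ℝ (Fin n))) 2) f g

theorem spinor_toTempered_smul {n N : ℕ} (c : ℂ) (f : SpinorL2 n N) :
    ((c • f : SpinorL2 n N) : 𝓢'(EuclideanSpace ℝ (Fin n), EuclideanSpace ℂ (Fin N))) =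
      c • (f : 𝓢'(EuclideanSpace ℝ (Fin n), EuclideanSpace ℂ (Fin N))) :=
  map_smul (Lp.toTemperedDistributionCLM (EuclideanSpace ℂ (Fin N))
    (volume : Measure (EuclideanSpace ℝ (Fin n))) 2) c f

theorem HasWeakPartial.unique {n N : ℕ} {j : Fin n} {f g g' : SpinorL2 n N}
    (h : HasWeakPartial j f g) (h' : HasWeakPartial j f g') : g = g' :=
  LinearMap.ker_eq_bot.mp (Lp.ker_toTemperedDistributionCLM_eq_bot
    (F := EuclideanSpace ℂ (Fin N)) (μ := (volume : Measure (EuclideanSpace ℝ (Fin n))))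
    (p := 2)) (h.symm.trans h')

theorem HasWeakPartial.add {n N : ℕ} {j : Fin n} {f₁ f₂ g₁ g₂ : SpinorL2 n N}
    (h₁ : HasWeakPartial j f₁ g₁) (h₂ : HasWeakPartial j f₂ g₂) :
    HasWeakPartial j (f₁ + f₂) (g₁ + g₂) := by
  unfold HasWeakPartial at *
  rw [spinor_toTempered_add, spinor_toTempered_add, LineDeriv.lineDerivOp_add, h₁, h₂]

theorem HasWeakPartial.smul {n N : ℕ} {j : Fin n} {f g : SpinorL2 n N} (c : ℂ)
    (h : HasWeakPartial j f g) : HasWeakPartial j (c • f) (c • g) := by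
  unfold HasWeakPartial at *
  rw [spinor_toTempered_smul, spinor_toTempered_smul, LineDeriv.lineDerivOp_smul, h]

/-- The Sobolev space `[W^{1,2}(ℝⁿ)]^N`: all first-order weak derivatives lie in `L²`. -/
def sobolevW12 (n N : ℕ) : Submodule ℂ (SpinorL2 n N) where
  carrier := {f | ∀ j : Fin n, ∃ g : SpinorL2 n N, HasWeakPartial j f g}
  add_mem' := fun h₁ h₂ j =>
    let ⟨g₁, hg₁⟩ := h₁ j
    let ⟨g₂, hg₂⟩ := h₂ j
    ⟨g₁ + g₂, hg₁.add hg₂⟩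
  zero_mem' := fun j => ⟨(0 : ℂ) • (0 : SpinorL2 n N), by
    have h : HasWeakPartial j ((0 : ℂ) • (0 : SpinorL2 n N)) ((0 : ℂ) • (0 : SpinorL2 n N)) := by
      unfold HasWeakPartial
      rw [spinor_toTempered_smul, LineDeriv.lineDerivOp_smul, zero_smul, zero_smul]
    simpa only [zero_smul] using h⟩
  smul_mem' := fun c _ h j =>
    let ⟨g, hg⟩ := h j
    ⟨c • g, hg.smul c⟩

/-- The weak partial derivative `∂_j : [W^{1,2}(ℝⁿ)]^N → [L²(ℝⁿ)]^N`. -/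
noncomputable def weakPartial {n N : ℕ} (j : Fin n) :
    sobolevW12 n N →ₗ[ℂ] SpinorL2 n N where
  toFun f := (f.2 j).choose
  map_add' f₁ f₂ := ((f₁ + f₂).2 j).choose_spec.unique
    ((f₁.2 j).choose_spec.add (f₂.2 j).choose_spec)
  map_smul' c f := ((c • f).2 j).choose_spec.unique ((f.2 j).choose_spec.smul c)

/-- The number of spinor components, `N = 2^⌊(n+1)/2⌋`. -/
abbrev spinorDim (n : ℕ) : ℕ := 2 ^ ((n + 1) / 2)

/-- `α 0, …, α n` (the last one being `β`) are anti-commuting Hermitian matrices with squares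
equal to the identity. -/
def IsDiracFamily {n N : ℕ} (α : Fin (n + 1) → Matrix (Fin N) (Fin N) ℂ) : Prop :=
  (∀ j, (α j).IsHermitian) ∧
    ∀ j k, α j * α k + α k * α j = if j = k then (2 : ℂ) • (1 : Matrix (Fin N) (Fin N) ℂ) else 0

/-- The free massless Dirac operator `H₀ = ∑_{j=1}^n α_j (-i ∂_j)` with domain
`[W^{1,2}(ℝⁿ)]^N`. -/
noncomputable def freeDirac {n N : ℕ} (α : Fin (n + 1) → Matrix (Fin N) (Fin N) ℂ) :
    SpinorL2 n N →ₗ.[ℂ] SpinorL2 n N where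
  domain := sobolevW12 n N
  toFun := ∑ j : Fin n,
    (((Matrix.toEuclideanCLM (𝕜 := ℂ) (α j.castSucc)).compLpL 2
      (volume : Measure (EuclideanSpace ℝ (Fin n))) : SpinorL2 n N →L[ℂ] SpinorL2 n N) :
        SpinorL2 n N →ₗ[ℂ] SpinorL2 n N) ∘ₗ ((-Complex.I) • weakPartial j)

theorem memLp_matrix_mulVec {n N : ℕ} {V : EuclideanSpace ℝ (Fin n) → Matrix (Fin N) (Fin N) ℂ}
    (hV : ∀ l m, MemLp (fun x => V x l m) ∞ volume) (f : SpinorL2 n N) :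
    MemLp (fun x => Matrix.toEuclideanCLM (𝕜 := ℂ) (V x) (f x)) 2 volume := by
  refine MemLp.of_eval_piLp fun l => ?_
  have h : ∀ m, MemLp (fun x => V x l m * f x m) 2 volume := fun m =>
    ((Lp.memLp f).eval_piLp m).mul (hV l m)
  have h' := memLp_finsetSum Finset.univ fun m _ => h m
  convert h' using 2 with x
  simp [Matrix.mulVec, dotProduct]

/-- The operator of multiplication by a matrix-valued `V ∈ [L^∞(ℝⁿ)]^{N×N}`,
`(V f)(x) = V(x) f(x)`. -/
noncomputable def mulOp {n N : ℕ} (V : EuclideanSpace ℝ (Fin n) → Matrix (Fin N) (Fin N) ℂ)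
    (hV : ∀ l m, MemLp (fun x => V x l m) ∞ volume) : SpinorL2 n N →ₗ[ℂ] SpinorL2 n N where
  toFun f := (memLp_matrix_mulVec hV f).toLp _
  map_add' f g := by
    rw [← MemLp.toLp_add]
    refine MemLp.toLp_congr _ _ ?_
    filter_upwards [Lp.coeFn_add f g] with x hx
    rw [hx, Pi.add_apply, Pi.add_apply, map_add]
  map_smul' c f := by
    rw [RingHom.id_apply, ← MemLp.toLp_const_smul]
    refine MemLp.toLp_congr _ _ ?_
    filter_upwards [Lp.coeFn_smul c f] with x hx
    rw [hx, Pi.smul_apply, Pi.smul_apply, map_smul]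

/-- The massless Dirac operator `H = H₀ + V` with domain `dom(H₀) = [W^{1,2}(ℝⁿ)]^N`. -/
noncomputable def dirac {n N : ℕ} (α : Fin (n + 1) → Matrix (Fin N) (Fin N) ℂ)
    (V : EuclideanSpace ℝ (Fin n) → Matrix (Fin N) (Fin N) ℂ)
    (hV : ∀ l m, MemLp (fun x => V x l m) ∞ volume) : SpinorL2 n N →ₗ.[ℂ] SpinorL2 n N :=
  mulOp V hV +ᵥ freeDirac α

/-- The bounded operator `R` is the resolvent `(T - z)⁻¹` of the (possibly unbounded) operator
`T`: it maps into `dom(T)` and is a two-sided inverse of `T - z : dom(T) → E`. -/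
def IsResolvent {E : Type*} [NormedAddCommGroup E] [NormedSpace ℂ E]
    (T : E →ₗ.[ℂ] E) (z : ℂ) (R : E →L[ℂ] E) : Prop :=
  (∀ f : E, ∃ h : R f ∈ T.domain, T ⟨R f, h⟩ - z • R f = f) ∧
    ∀ f : T.domain, R (T f - z • (f : E)) = f

/-- The resolvent set of a (possibly unbounded) operator. -/
def pmapResolventSet {E : Type*} [NormedAddCommGroup E] [NormedSpace ℂ E]
    (T : E →ₗ.[ℂ] E) : Set ℂ :=
  {z | ∃ R : E →L[ℂ] E, IsResolvent T z R}

/-- `T` is trace class: `∑ᵢ ⟨eᵢ, |T| eᵢ⟩ < ∞` for every orthonormal basis `(eᵢ)`, where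
`|T| = (T* T)^{1/2}`. -/
def IsTraceClass {E : Type*} [NormedAddCommGroup E] [InnerProductSpace ℂ E] [CompleteSpace E]
    (T : E →L[ℂ] E) : Prop :=
  ∀ (s : Set E) (b : HilbertBasis s ℂ E),
    Summable fun i => (inner ℂ (b i) (CFC.abs T (b i))).re

/-! The difference of the k-th powers telescopes into terms `R ^ (j + 1) * (-V) * R₀ ^ (k - j)`,
each containing k + 1 resolvents. For 0 < a < 1 the singular values of ⟨x⟩^(-a) (H₀ - z)⁻¹ decay
like j^(-γ) for every γ < a/n, and orders of decay add under multiplication. Since ρ > n and k ≥ n,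
the potential supplies k + 1 weights ⟨x⟩^(-a) with n < (k + 1)a < k + 1, one for each resolvent, so
the total order (k + 1)γ can be taken larger than 1, which forces trace class.

The weights have to be carried through powers of the resolvents. Conjugating H₀ by a power of (1 +
|εx|²)^(-a/2) only adds a bounded potential of norm O(ε), the gradient of the logarithm of the
weight. For small ε a Neumann series keeps z in the resolvent set, whence R W^j = W^j S_j with S_j
the resolvent of a bounded perturbation of H₀ (`mul_weightOp_eq`, `weightOp_mul_eq`). By the second
resolvent identity W S_j is no worse than W (H₀ - z)⁻¹. Self-adjointness of V plays no role here.

Singular values enter only through approximation by finite rank (`ApproxOrder`): orders add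
(`ApproxOrder.mul`), and order above 1 gives trace class (`ApproxOrder.isTraceClass`). The decay for
W (H₀ - z)⁻¹ (`approxOrder_of_decay`) is elementary. The free resolvent produces functions with
Lipschitz translates in L², which are well approximated by step functions on small cubes; the side
of the cubes is adjusted to each dyadic shell.

The resolvent set claims come from the explicit Fourier multiplier of H₀ and, for Hermitian V, from
switching on V in small steps, the bound |Im z|⁻¹ on the resolvent being preserved at each step. -/

/-! ### Finite-rank approximation and the trace class criterion -/

section ApproximationNumbers

variable {E : Type*} [NormedAddCommGroup E] [InnerProductSpace ℂ E]

/-- `T` is within operator-norm distance `ε` of an operator of rank at most `r`. -/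
def ApproxBy (T : E →L[ℂ] E) (r ε : ℝ) : Prop :=
  ∃ F : E →L[ℂ] E, Module.Finite ℂ F.range ∧ (Module.finrank ℂ F.range : ℝ) ≤ r ∧ ‖T - F‖ ≤ ε

theorem ApproxBy.mono {T : E →L[ℂ] E} {r r' ε ε' : ℝ} (h : ApproxBy T r ε) (hr : r ≤ r')
    (hε : ε ≤ ε') : ApproxBy T r' ε' := by
  obtain ⟨F, h1, h2, h3⟩ := h
  exact ⟨F, h1, h2.trans hr, h3.trans hε⟩

theorem ApproxBy.of_norm_le {T : E →L[ℂ] E} {ε : ℝ} (h : ‖T‖ ≤ ε) : ApproxBy T 0 ε := by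
  have h0 : (0 : E →L[ℂ] E).range = ⊥ := LinearMap.range_zero
  refine ⟨0, ?_, ?_, by simpa using h⟩
  · rw [h0]; infer_instance
  · rw [h0]; simp

theorem finite_range_add {F G : E →L[ℂ] E} (hF : Module.Finite ℂ F.range)
    (hG : Module.Finite ℂ G.range) : Module.Finite ℂ (F + G).range ∧
      Module.finrank ℂ (F + G).range ≤ Module.finrank ℂ F.range + Module.finrank ℂ G.range := by
  have hle : (F + G).range ≤ F.range ⊔ G.range := by
    rintro _ ⟨x, rfl⟩
    exact Submodule.add_mem_sup ⟨x, rfl⟩ ⟨x, rfl⟩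
  exact ⟨Submodule.finiteDimensional_of_le hle,
    (Submodule.finrank_mono hle).trans (Submodule.finrank_add_le_finrank_add_finrank _ _)⟩

theorem finite_range_mul_left {F : E →L[ℂ] E} (hF : Module.Finite ℂ F.range) (B : E →L[ℂ] E) :
    Module.Finite ℂ (B * F).range ∧
      Module.finrank ℂ (B * F).range ≤ Module.finrank ℂ F.range := by
  have h : (B * F).range = F.range.map (B : E →ₗ[ℂ] E) := by
    ext y; simp [Submodule.mem_map]
  rw [h]
  exact ⟨inferInstance, Submodule.finrank_map_le _ _⟩

theorem finite_range_mul_right {F : E →L[ℂ] E} (hF : Module.Finite ℂ F.range) (B : E →L[ℂ] E) :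
    Module.Finite ℂ (F * B).range ∧
      Module.finrank ℂ (F * B).range ≤ Module.finrank ℂ F.range := by
  have hle : (F * B).range ≤ F.range := by
    rintro _ ⟨x, rfl⟩
    exact ⟨B x, rfl⟩
  exact ⟨Submodule.finiteDimensional_of_le hle, Submodule.finrank_mono hle⟩

theorem ApproxBy.add {T S : E →L[ℂ] E} {r s ε δ : ℝ} (hT : ApproxBy T r ε) (hS : ApproxBy S s δ) :
    ApproxBy (T + S) (r + s) (ε + δ) := by
  obtain ⟨F, h1, h2, h3⟩ := hT
  obtain ⟨G, g1, g2, g3⟩ := hS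
  obtain ⟨k1, k2⟩ := finite_range_add h1 g1
  refine ⟨F + G, k1, ?_, ?_⟩
  · have : (Module.finrank ℂ (F + G).range : ℝ) ≤
      Module.finrank ℂ F.range + Module.finrank ℂ G.range := by exact_mod_cast k2
    linarith
  · rw [add_sub_add_comm]
    exact (norm_add_le _ _).trans (add_le_add h3 g3)

/-- The product (T - F)(S - G) of the two errors differs from TS by FS + (T - F)G, whose rank is at
most rank F + rank G. Thus ranks add while errors multiply. -/
theorem ApproxBy.mul {T S : E →L[ℂ] E} {r s ε δ : ℝ} (hT : ApproxBy T r ε) (hS : ApproxBy S s δ) :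
    ApproxBy (T * S) (r + s) (ε * δ) := by
  obtain ⟨F, h1, h2, h3⟩ := hT
  obtain ⟨G, g1, g2, g3⟩ := hS
  obtain ⟨a1, a2⟩ := finite_range_mul_right h1 S
  obtain ⟨b1, b2⟩ := finite_range_mul_left g1 (T - F)
  obtain ⟨k1, k2⟩ := finite_range_add a1 b1
  refine ⟨F * S + (T - F) * G, k1, ?_, ?_⟩
  · have : (Module.finrank ℂ (F * S + (T - F) * G).range : ℝ) ≤
      Module.finrank ℂ F.range + Module.finrank ℂ G.range := by
        exact_mod_cast k2.trans (add_le_add a2 b2)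
    linarith
  · have : T * S - (F * S + (T - F) * G) = (T - F) * (S - G) := by noncomm_ring
    rw [this]
    exact (norm_mul_le _ _).trans (mul_le_mul h3 g3 (norm_nonneg _) ((norm_nonneg _).trans h3))

/-- An operator whose values lie uniformly close to a fixed finite-dimensional subspace is close
to an operator of finite rank. -/
theorem ApproxBy.of_subspace {T : E →L[ℂ] E} {r ε : ℝ} (S : Submodule ℂ E)
    [FiniteDimensional ℂ S] (hS : (Module.finrank ℂ S : ℝ) ≤ r) (hε : 0 ≤ ε)
    (h : ∀ f, ∃ g ∈ S, ‖T f - g‖ ≤ ε * ‖f‖) : ApproxBy T r ε := by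
  -- Orthogonal projection onto `S` gives the best approximation and depends linearly on `T f`,
  -- whereas the given `g` need not.
  have hle : (S.starProjection * T).range ≤ S := by
    rintro _ ⟨x, rfl⟩
    exact S.starProjection_apply_mem (T x)
  refine ⟨S.starProjection * T, Submodule.finiteDimensional_of_le hle, ?_, ?_⟩
  · exact le_trans (by exact_mod_cast Submodule.finrank_mono hle) hS
  · refine ContinuousLinearMap.opNorm_le_bound _ hε fun f => ?_
    obtain ⟨g, hg, hfg⟩ := h f
    refine le_trans ?_ hfg
    have := S.starProjection_minimal (y := T f)
    rw [sub_apply, mul_apply_eq_comp, this]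
    exact ciInf_le ⟨0, by rintro _ ⟨x, rfl⟩; positivity⟩ (⟨g, hg⟩ : S)

/-- The approximation numbers of `T` decay like `j ^ (-γ)`. -/
def ApproxOrder (γ : ℝ) (T : E →L[ℂ] E) : Prop :=
  ∃ C : ℝ, ∀ t : ℝ, 1 ≤ t → ApproxBy T (C * t) (C * t ^ (-γ))

theorem ApproxOrder.of_bounded (T : E →L[ℂ] E) : ApproxOrder 0 T :=
  ⟨‖T‖, fun t ht => (ApproxBy.of_norm_le le_rfl).mono (by positivity) (by simp)⟩

/-- Plays the role of Hölder's inequality for Schatten classes: k + 1 factors of small order γ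
combine to order (k + 1)γ. -/
theorem ApproxOrder.mul {T S : E →L[ℂ] E} {γ δ : ℝ} (hT : ApproxOrder γ T)
    (hS : ApproxOrder δ S) : ApproxOrder (γ + δ) (T * S) := by
  obtain ⟨C, hC⟩ := hT
  obtain ⟨D, hD⟩ := hS
  refine ⟨max (C + D) (C * D), fun t ht => ((hC t ht).mul (hD t ht)).mono ?_ ?_⟩
  · rw [← add_mul]
    exact mul_le_mul_of_nonneg_right (le_max_left _ _) (by linarith)
  · rw [neg_add, Real.rpow_add (by linarith), mul_mul_mul_comm]
    exact mul_le_mul_of_nonneg_right (le_max_right _ _) (by positivity)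

theorem ApproxOrder.mul_bounded {T : E →L[ℂ] E} {γ : ℝ} (hT : ApproxOrder γ T)
    (B : E →L[ℂ] E) : ApproxOrder γ (T * B) := by
  simpa using hT.mul (ApproxOrder.of_bounded B)

theorem ApproxOrder.add {T S : E →L[ℂ] E} {γ : ℝ} (hT : ApproxOrder γ T)
    (hS : ApproxOrder γ S) : ApproxOrder γ (T + S) := by
  obtain ⟨C, hC⟩ := hT
  obtain ⟨D, hD⟩ := hS
  exact ⟨C + D, fun t ht => ((hC t ht).add (hD t ht)).mono (by rw [add_mul]) (by rw [add_mul])⟩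

theorem ApproxOrder.zero (γ : ℝ) : ApproxOrder γ (0 : E →L[ℂ] E) :=
  ⟨0, fun t _ => (ApproxBy.of_norm_le (by simp)).mono (by simp) (le_refl (0 * t ^ (-γ)) |>.trans
    (by simp))⟩

theorem ApproxOrder.sum {ι : Type*} (s : Finset ι) {T : ι → E →L[ℂ] E} {γ : ℝ}
    (h : ∀ i ∈ s, ApproxOrder γ (T i)) : ApproxOrder γ (∑ i ∈ s, T i) := by
  classical
  induction s using Finset.induction_on with
  | empty => simpa using ApproxOrder.zero γ
  | insert i s hi ih =>
    rw [Finset.sum_insert hi]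
    exact (h i (Finset.mem_insert_self _ _)).add
      (ih fun j hj => h j (Finset.mem_insert_of_mem hj))

variable [CompleteSpace E]

theorem norm_cfcAbs_apply (T : E →L[ℂ] E) (x : E) : ‖CFC.abs T x‖ = ‖T x‖ := by
  have h1 : IsSelfAdjoint (CFC.abs T) := (CFC.abs_nonneg T).isSelfAdjoint
  have h : inner ℂ (CFC.abs T x) (CFC.abs T x) = inner ℂ (T x) (T x) := by
    rw [← ContinuousLinearMap.adjoint_inner_right, ← ContinuousLinearMap.star_eq_adjoint,
      h1.star_eq, ← mul_apply_eq_comp, CFC.abs_mul_abs,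
      mul_apply_eq_comp, ContinuousLinearMap.star_eq_adjoint,
      ContinuousLinearMap.adjoint_inner_right]
  rw [inner_self_eq_norm_sq_to_K, inner_self_eq_norm_sq_to_K] at h
  have h' : ‖CFC.abs T x‖ ^ 2 = ‖T x‖ ^ 2 := by exact_mod_cast h
  exact (sq_eq_sq₀ (norm_nonneg _) (norm_nonneg _)).mp h'

/-- Avoids the polar decomposition. On ker F one has ‖|T|x‖ = ‖Tx‖ = ‖(T - F)x‖ ≤ ε‖x‖, and (ker F)ᗮ
has dimension rank F, so |T| composed with the projection onto (ker F)ᗮ is the required approximant.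
-/
theorem ApproxBy.cfcAbs {T : E →L[ℂ] E} {r ε : ℝ} (h : ApproxBy T r ε) :
    ApproxBy (CFC.abs T) r ε := by
  obtain ⟨F, h1, h2, h3⟩ := h
  have hc : IsClosed (F.ker : Set E) := F.isClosed_ker
  have : CompleteSpace F.ker := hc.completeSpace_coe
  have e1 := (F : E →ₗ[ℂ] E).quotKerEquivRange
  have e2 := F.ker.quotientEquivOfIsCompl F.kerᗮ (Submodule.isCompl_orthogonal _)
  have e : F.range ≃ₗ[ℂ] F.kerᗮ := e1.symm.trans e2
  have : FiniteDimensional ℂ F.kerᗮ := e.finiteDimensional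
  have hle : (CFC.abs T * F.kerᗮ.starProjection).range ≤
      F.kerᗮ.map ((CFC.abs T : E →L[ℂ] E) : E →ₗ[ℂ] E) := by
    rintro _ ⟨x, rfl⟩
    exact ⟨_, F.kerᗮ.starProjection_apply_mem x, rfl⟩
  refine ⟨CFC.abs T * F.kerᗮ.starProjection, Submodule.finiteDimensional_of_le hle, ?_, ?_⟩
  · refine le_trans ?_ h2
    rw [e.finrank_eq]
    exact_mod_cast (Submodule.finrank_mono hle).trans (Submodule.finrank_map_le _ _)
  · refine ContinuousLinearMap.opNorm_le_bound _ ((norm_nonneg _).trans h3) fun x => ?_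
    have h4 : (CFC.abs T - CFC.abs T * F.kerᗮ.starProjection) x =
        CFC.abs T (F.ker.starProjection x) := by
      rw [sub_apply, mul_apply_eq_comp, ← map_sub]
      congr 1
      rw [Submodule.starProjection_orthogonal_val, sub_sub_cancel]
    have h5 : F (F.ker.starProjection x) = 0 := F.ker.starProjection_apply_mem x
    have h6 : T (F.ker.starProjection x) = (T - F) (F.ker.starProjection x) := by
      rw [sub_apply, h5, sub_zero]
    rw [h4, norm_cfcAbs_apply, h6]
    refine ((T - F).le_opNorm _).trans ?_
    exact mul_le_mul h3 (F.ker.norm_starProjection_apply_le x) (norm_nonneg _) ((norm_nonneg _).trans h3)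

/-- For an orthonormal system `b`, the diagonal of a finite-rank operator `D` is summable with
sum at most `rank D * ‖D‖`. -/
theorem sum_norm_inner_le_finrank {ι : Type*} {b : ι → E} (hb : Orthonormal ℂ b) (D : E →L[ℂ] E)
    [FiniteDimensional ℂ D.range] (s : Finset ι) :
    ∑ i ∈ s, ‖inner ℂ (b i) (D (b i))‖ ≤ Module.finrank ℂ D.range * ‖D‖ := by
  set u := stdOrthonormalBasis ℂ D.range
  -- Expanding `D (b i)` in an orthonormal basis `u` of the range reduces the sum to rank-many
  -- terms; Cauchy–Schwarz and Bessel bound each by ‖u j‖ ‖D* u j‖ ≤ ‖D‖.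
  have h1 : ∀ i, ‖inner ℂ (b i) (D (b i))‖ ≤
      ∑ j, ‖inner ℂ (b i) (u j : E)‖ * ‖inner ℂ (b i) (D.adjoint (u j))‖ := by
    intro i
    have h2 : D (b i) = ∑ j, inner ℂ (u j : E) (D (b i)) • (u j : E) := by
      have := congrArg (Subtype.val) (u.sum_repr' ⟨D (b i), ⟨b i, rfl⟩⟩)
      rw [Submodule.coe_sum] at this
      simpa using this.symm
    rw [h2, inner_sum]
    refine (norm_sum_le _ _).trans (Finset.sum_le_sum fun j _ => ?_)
    rw [inner_smul_right, norm_mul, mul_comm]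
    gcongr
    rw [← ContinuousLinearMap.adjoint_inner_left, norm_inner_symm]
  refine (Finset.sum_le_sum fun i _ => h1 i).trans ?_
  rw [Finset.sum_comm]
  have h3 : ∀ v : E, ∑ i ∈ s, ‖inner ℂ (b i) v‖ ^ 2 ≤ ‖v‖ ^ 2 := fun v =>
    hb.sum_inner_products_le v
  have h4 : ∀ j, ∑ i ∈ s, ‖inner ℂ (b i) (u j : E)‖ * ‖inner ℂ (b i) (D.adjoint (u j))‖ ≤ ‖D‖ := by
    intro j
    have hu : ‖(u j : E)‖ = 1 := u.orthonormal.1 j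
    refine (Real.sum_mul_le_sqrt_mul_sqrt _ _ _).trans ?_
    have h5 : √(∑ i ∈ s, ‖inner ℂ (b i) (u j : E)‖ ^ 2) ≤ 1 := by
      refine Real.sqrt_le_one.mpr ?_
      simpa [hu] using h3 (u j : E)
    have h6 : √(∑ i ∈ s, ‖inner ℂ (b i) (D.adjoint (u j))‖ ^ 2) ≤ ‖D‖ := by
      rw [Real.sqrt_le_left (norm_nonneg _)]
      refine (h3 _).trans ?_
      gcongr
      refine (D.adjoint.le_opNorm _).trans ?_
      rw [hu, mul_one]
      exact (ContinuousLinearMap.adjoint.norm_map D).le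
    calc _ ≤ 1 * ‖D‖ := mul_le_mul h5 h6 (by positivity) zero_le_one
      _ = _ := one_mul _
  refine (Finset.sum_le_sum fun j _ => h4 j).trans ?_
  simp

/-- Approximants `F m` of rank about 2^m converge to |T|. Their increments have rank at most 3C·2^m
and norm at most 2C·q^m with q = 2^(-γ), so each adds at most 6C²(2q)^m to any diagonal sum; this is
summable because γ > 1 means 2q < 1. -/
theorem ApproxOrder.isTraceClass {T : E →L[ℂ] E} {γ : ℝ} (hγ : 1 < γ) (h : ApproxOrder γ T) :
    IsTraceClass T := by
  intro s b
  obtain ⟨C, hC⟩ := h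
  have hC' : ∀ m : ℕ, ApproxBy (CFC.abs T) (C * 2 ^ m) (C * (2 ^ (-γ)) ^ m) := fun m => by
    have := (hC (2 ^ m) (one_le_pow₀ one_le_two)).cfcAbs
    rwa [← Real.rpow_natCast, ← Real.rpow_mul (by norm_num), mul_comm (m : ℝ), Real.rpow_mul (by norm_num),
      Real.rpow_natCast, Real.rpow_natCast] at this
  choose F hF1 hF2 hF3 using hC'
  set q : ℝ := 2 ^ (-γ) with hq
  have hq0 : 0 < q := by positivity
  have hq1 : 2 * q < 1 := by
    have : q < 2 ^ (-1 : ℝ) := Real.rpow_lt_rpow_of_exponent_lt one_lt_two (by linarith)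
    rw [Real.rpow_neg_one] at this
    linarith
  have hC0 : 0 ≤ C := by
    have := (norm_nonneg _).trans (hF3 0)
    simpa using this
  have hD : ∀ m, Module.Finite ℂ (F (m + 1) - F m).range ∧
      (Module.finrank ℂ (F (m + 1) - F m).range : ℝ) ≤ 3 * C * 2 ^ m := fun m => by
    have hn : (-F m).range = (F m).range := by
      ext y
      constructor
      · rintro ⟨x, rfl⟩; exact ⟨-x, by simp⟩
      · rintro ⟨x, rfl⟩; exact ⟨-x, by simp⟩
    have hf : Module.Finite ℂ (-F m).range := by rw [hn]; exact hF1 m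
    obtain ⟨k1, k2⟩ := finite_range_add (hF1 (m + 1)) hf
    rw [← sub_eq_add_neg] at k1 k2
    rw [hn] at k2
    refine ⟨k1, ?_⟩
    have k3 : (Module.finrank ℂ (F (m + 1) - F m).range : ℝ) ≤
      Module.finrank ℂ (F (m + 1)).range + Module.finrank ℂ (F m).range := by exact_mod_cast k2
    have := hF2 m
    have := hF2 (m + 1)
    rw [pow_succ] at this
    linarith
  have hDn : ∀ m, ‖F (m + 1) - F m‖ ≤ 2 * C * q ^ m := fun m => by
    have h1 := hF3 m
    have h2 := hF3 (m + 1)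
    have h3 : F (m + 1) - F m = (CFC.abs T - F m) - (CFC.abs T - F (m + 1)) := by abel
    rw [h3]
    refine (norm_sub_le _ _).trans ?_
    have h4 : C * q ^ (m + 1) ≤ C * q ^ m :=
      mul_le_mul_of_nonneg_left (pow_le_pow_of_le_one hq0.le (by linarith) (Nat.le_succ m)) hC0
    linarith
  have key : ∀ (t : Finset s) (M : ℕ), ∑ i ∈ t, ‖inner ℂ (b i) (F M (b i))‖ ≤
      C * ‖F 0‖ + ∑ m ∈ Finset.range M, 6 * C ^ 2 * (2 * q) ^ m := by
    intro t M
    induction M with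
    | zero =>
      have := hF1 0
      refine (sum_norm_inner_le_finrank b.orthonormal (F 0) t).trans ?_
      have := hF2 0
      simp only [pow_zero, mul_one] at this
      simpa using mul_le_mul_of_nonneg_right this (norm_nonneg _)
    | succ M ih =>
      have := (hD M).1
      have h1 := sum_norm_inner_le_finrank b.orthonormal (F (M + 1) - F M) t
      have h2 : (Module.finrank ℂ (F (M + 1) - F M).range : ℝ) * ‖F (M + 1) - F M‖ ≤
          6 * C ^ 2 * (2 * q) ^ M := by
        refine (mul_le_mul (hD M).2 (hDn M) (norm_nonneg _) (by positivity)).trans (le_of_eq ?_)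
        rw [mul_pow]; ring
      rw [Finset.sum_range_succ, ← add_assoc]
      refine le_trans ?_ (add_le_add ih (h1.trans h2))
      rw [← Finset.sum_add_distrib]
      refine Finset.sum_le_sum fun i _ => ?_
      refine le_trans (le_of_eq ?_) (norm_add_le _ _)
      rw [← inner_add_right, sub_apply, add_sub_cancel]
  have hgeo : Summable fun m : ℕ => 6 * C ^ 2 * (2 * q) ^ m :=
    (summable_geometric_of_lt_one (by positivity) hq1).mul_left _
  have hlim : Filter.Tendsto F Filter.atTop (nhds (CFC.abs T)) := by
    rw [tendsto_iff_norm_sub_tendsto_zero]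
    refine squeeze_zero (fun _ => norm_nonneg _) (fun m => (norm_sub_rev _ _).trans_le (hF3 m)) ?_
    simpa using (tendsto_pow_atTop_nhds_zero_of_lt_one hq0.le (by linarith)).const_mul C
  -- The bound on diagonal sums of `F M` is uniform in `M`, so it survives the norm limit;
  -- summability follows since the diagonal of |T| is nonnegative.
  refine summable_of_sum_le (c := C * ‖F 0‖ + ∑' m : ℕ, 6 * C ^ 2 * (2 * q) ^ m) (fun i => ?_) fun t => ?_
  · have := (ContinuousLinearMap.nonneg_iff_isPositive _).mp (CFC.abs_nonneg T)
    exact this.re_inner_nonneg_right (b i)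
  · refine (Finset.sum_le_sum fun i _ => Complex.re_le_norm _).trans ?_
    have h1 : Filter.Tendsto (fun M => ∑ i ∈ t, ‖inner ℂ (b i) (F M (b i))‖) Filter.atTop
        (nhds (∑ i ∈ t, ‖inner ℂ (b i) (CFC.abs T (b i))‖)) := by
      refine tendsto_finsetSum _ fun i _ => ?_
      exact (tendsto_const_nhds.inner
        (((ContinuousLinearMap.apply ℂ E (b i)).continuous.tendsto _).comp hlim)).norm
    refine le_of_tendsto' h1 fun M => (key t M).trans ?_
    gcongr
    exact hgeo.sum_le_tsum _ fun _ _ => by positivity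

end ApproximationNumbers

/-! ### Resolvent identities for unbounded operators -/

section Resolvents

variable {E : Type*} [NormedAddCommGroup E] [NormedSpace ℂ E]
  {T : E →ₗ.[ℂ] E} {z : ℂ} {R : E →L[ℂ] E}

theorem IsResolvent.mem_domain (h : IsResolvent T z R) (f : E) : R f ∈ T.domain := (h.1 f).1

theorem IsResolvent.apply_sub (h : IsResolvent T z R) (f : E) :
    T ⟨R f, h.mem_domain f⟩ - z • R f = f := (h.1 f).2

theorem IsResolvent.eq_apply (h : IsResolvent T z R) {f g : E} (hf : f ∈ T.domain)
    (hfg : T ⟨f, hf⟩ - z • f = g) : R g = f := by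
  rw [← hfg]
  exact h.2 ⟨f, hf⟩

/-- Second resolvent identity. -/
theorem IsResolvent.sub_eq {R' D : E →L[ℂ] E} (h : IsResolvent T z R)
    (h' : IsResolvent ((D : E →ₗ[ℂ] E) +ᵥ T) z R') : R' = R * (1 - D * R') := by
  ext f
  refine (h.eq_apply (h'.mem_domain f) ?_).symm
  have := h'.apply_sub f
  rw [LinearPMap.vadd_apply] at this
  simp only [ContinuousLinearMap.coe_coe] at this
  change _ = f - D (R' f)
  rw [eq_sub_iff_add_eq]
  refine Eq.trans ?_ this
  abel

/-- Neumann series: resolvents persist under small bounded perturbations. -/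
theorem IsResolvent.exists_of_norm_mul_lt_one [CompleteSpace E] (h : IsResolvent T z R)
    (D : E →L[ℂ] E) (hD : ‖D‖ * ‖R‖ < 1) :
    ∃ R', IsResolvent ((D : E →ₗ[ℂ] E) +ᵥ T) z R' := by
  have hn : ‖-(D * R)‖ < 1 := by
    rw [norm_neg]
    exact (norm_mul_le _ _).trans_lt hD
  -- On the domain, T + D - z = (1 + DR)(T - z), so the new resolvent is R(1 + DR)⁻¹.
  set u := Units.oneSub (-(D * R)) hn with hu
  have huv : (u : E →L[ℂ] E) = 1 + D * R := by simp [hu]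
  have hu1 : (1 + D * R) * (↑u⁻¹ : E →L[ℂ] E) = 1 := by rw [← huv]; simp
  have hu2 : (↑u⁻¹ : E →L[ℂ] E) * (1 + D * R) = 1 := by rw [← huv]; simp
  refine ⟨R * ↑u⁻¹, fun f => ⟨h.mem_domain _, ?_⟩, fun f => ?_⟩
  · have h1 := h.apply_sub ((↑u⁻¹ : E →L[ℂ] E) f)
    have h2 := congrArg (fun A : E →L[ℂ] E => A f) hu1
    simp only [mul_apply_eq_comp, one_apply_eq_self, add_apply] at h2
    rw [LinearPMap.vadd_apply]
    simp only [mul_apply_eq_comp, ContinuousLinearMap.coe_coe]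
    rw [add_sub_assoc]
    refine Eq.trans ?_ h2
    rw [add_comm]
    exact congrArg (· + _) h1
  · have h1 := h.2 f
    have h2 := congrArg (fun A : E →L[ℂ] E => A (T f - z • (f : E))) hu2
    simp only [mul_apply_eq_comp, one_apply_eq_self, add_apply, h1] at h2
    rw [LinearPMap.vadd_apply]
    simp only [mul_apply_eq_comp, ContinuousLinearMap.coe_coe]
    rw [add_sub_assoc, add_comm]
    exact (congrArg R h2).trans h1

/-- Intertwining of resolvents: if `T W ⊇ W S` then `R_T W = W R_S`. -/
theorem IsResolvent.mul_eq_mul {S : E →ₗ.[ℂ] E} {R' W : E →L[ℂ] E} (h : IsResolvent T z R)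
    (h' : IsResolvent S z R')
    (hW : ∀ f (hf : f ∈ S.domain), ∃ hWf : W f ∈ T.domain, T ⟨W f, hWf⟩ = W (S ⟨f, hf⟩)) :
    R * W = W * R' := by
  ext f
  obtain ⟨h1, h2⟩ := hW (R' f) (h'.mem_domain f)
  refine (h.eq_apply h1 ?_ : R (W f) = W (R' f))
  rw [h2, ← map_smul, ← map_sub, h'.apply_sub]

/-- Telescoping of R - R₀ = -R D R₀. What matters is the count: every term has (j + 1) + (k - j) = k
+ 1 resolvents around one copy of D. -/
theorem IsResolvent.pow_sub_pow {R₀ D : E →L[ℂ] E} (h₀ : IsResolvent T z R₀)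
    (h : IsResolvent ((D : E →ₗ[ℂ] E) +ᵥ T) z R) (k : ℕ) :
    R ^ k - R₀ ^ k = ∑ j ∈ Finset.range k, R ^ (j + 1) * (-D) * R₀ ^ (k - j) := by
  have h1 : R - R₀ = R * (-D) * R₀ := by
    ext f
    have h2 := h.eq_apply (f := R₀ f) (h₀.mem_domain f) rfl
    rw [LinearPMap.vadd_apply, add_sub_assoc, h₀.apply_sub] at h2
    simp only [ContinuousLinearMap.coe_coe, map_add] at h2
    simp only [sub_apply, mul_apply_eq_comp, neg_apply, map_neg]
    rw [sub_eq_iff_eq_add, ← sub_eq_neg_add, eq_sub_iff_add_eq', h2]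
  induction k with
  | zero => simp
  | succ k ih =>
    have h3 : R ^ (k + 1) - R₀ ^ (k + 1) = (R ^ k - R₀ ^ k) * R₀ + R ^ k * (R - R₀) := by
      rw [pow_succ, pow_succ]; noncomm_ring
    rw [h3, ih, Finset.sum_mul, Finset.sum_range_succ, h1]
    congr 1
    · refine Finset.sum_congr rfl fun j hj => ?_
      rw [Nat.succ_sub (Finset.mem_range.mp hj).le, pow_succ R₀, mul_assoc]
    · rw [Nat.succ_sub le_rfl, Nat.sub_self, pow_one, pow_succ]
      noncomm_ring

end Resolvents

/-! ### Symmetric operators at nonreal points -/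

section Symmetric

variable {E : Type*} [NormedAddCommGroup E] [InnerProductSpace ℂ E]
  {T : E →ₗ.[ℂ] E} {z : ℂ}

/-- If all `⟪f, T f⟫` are real, then `T - z` is bounded below by `|Im z|`. -/
theorem norm_sub_smul_ge_of_symmetric (hT : ∀ f : T.domain, (inner ℂ (f : E) (T f)).im = 0)
    (f : T.domain) : |z.im| * ‖(f : E)‖ ≤ ‖T f - z • (f : E)‖ := by
  have h1 : (inner ℂ (f : E) (T f - z • (f : E))).im = -z.im * ‖(f : E)‖ ^ 2 := by
    rw [inner_sub_right, inner_smul_right, inner_self_eq_norm_sq_to_K, Complex.sub_im, hT]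
    simp [← Complex.ofReal_pow]
  have h2 : |z.im| * ‖(f : E)‖ ^ 2 ≤ ‖(f : E)‖ * ‖T f - z • (f : E)‖ := by
    refine le_trans ?_ (norm_inner_le_norm (𝕜 := ℂ) _ _)
    refine le_trans (le_of_eq ?_) (Complex.abs_im_le_norm _)
    rw [h1, abs_mul, abs_neg, abs_of_nonneg (sq_nonneg ‖(f : E)‖)]
  rcases eq_or_lt_of_le (norm_nonneg (f : E)) with h0 | h0
  · rw [← h0]; simp
  · refine le_of_mul_le_mul_left ?_ h0
    linarith

/-- The lower bound by |Im z| makes T - z injective, so a right inverse is automatically two-sided.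
-/
theorem IsResolvent.of_right_inverse_of_symmetric {R : E →L[ℂ] E} (hz : z.im ≠ 0)
    (hT : ∀ f : T.domain, (inner ℂ (f : E) (T f)).im = 0)
    (h : ∀ f : E, ∃ h : R f ∈ T.domain, T ⟨R f, h⟩ - z • R f = f) : IsResolvent T z R := by
  refine ⟨h, fun f => ?_⟩
  obtain ⟨h1, h2⟩ := h (T f - z • (f : E))
  set g : T.domain := ⟨R (T f - z • (f : E)), h1⟩
  have h3 := norm_sub_smul_ge_of_symmetric (z := z) hT (g - f)
  have h4 : T (g - f) - z • ((g - f : T.domain) : E) = 0 := by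
    rw [LinearPMap.map_sub, Submodule.coe_sub, smul_sub]
    have h5 : T g - z • (g : E) = T f - z • (f : E) := h2
    rw [sub_sub_sub_comm, h5, sub_self]
  rw [h4, norm_zero] at h3
  have h6 : ‖((g - f : T.domain) : E)‖ = 0 := by
    have := abs_pos.mpr hz
    nlinarith [norm_nonneg ((g - f : T.domain) : E)]
  rw [norm_eq_zero, Submodule.coe_sub, sub_eq_zero] at h6
  exact h6

theorem IsResolvent.norm_le_of_symmetric {R : E →L[ℂ] E} (hz : z.im ≠ 0)
    (hT : ∀ f : T.domain, (inner ℂ (f : E) (T f)).im = 0) (h : IsResolvent T z R) :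
    ‖R‖ ≤ |z.im|⁻¹ := by
  refine ContinuousLinearMap.opNorm_le_bound _ (by positivity) fun f => ?_
  have := norm_sub_smul_ge_of_symmetric (z := z) hT ⟨R f, h.mem_domain f⟩
  rw [h.apply_sub] at this
  rw [inv_mul_eq_div, le_div_iff₀ (abs_pos.mpr hz), mul_comm]
  exact this

/-- Bounded symmetric perturbations of a symmetric operator keep nonreal points in the
resolvent set. -/
theorem exists_isResolvent_of_symmetric [CompleteSpace E] {R : E →L[ℂ] E} (hz : z.im ≠ 0)
    (hT : ∀ f : T.domain, (inner ℂ (f : E) (T f)).im = 0) (h : IsResolvent T z R)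
    (D : E →L[ℂ] E) (hD : ∀ f : E, (inner ℂ f (D f)).im = 0) :
    ∃ R', IsResolvent ((D : E →ₗ[ℂ] E) +ᵥ T) z R' := by
  -- `D` is added in `m` equal portions. Each intermediate operator is symmetric, so its resolvent
  -- is again bounded by |Im z|⁻¹ and the same `m` makes every Neumann series converge.
  obtain ⟨m, hm⟩ := exists_nat_gt (‖D‖ * |z.im|⁻¹)
  have hm0 : (0 : ℝ) < m := lt_of_le_of_lt (by positivity) hm
  set D' : E →L[ℂ] E := ((m : ℝ)⁻¹ : ℂ) • D with hD'
  have hD'n : ‖D'‖ * |z.im|⁻¹ < 1 := by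
    rw [hD', norm_smul, mul_assoc]
    simp only [Complex.ofReal_natCast, norm_inv, Complex.norm_natCast]
    rw [inv_mul_eq_div, div_lt_one hm0]
    exact hm
  have hreal : ∀ (c : ℝ) (f : E), (inner ℂ f (((c : ℂ) • D) f)).im = 0 := fun c f => by
    rw [smul_apply, inner_smul_right, Complex.im_ofReal_mul, hD f, mul_zero]
  have key : ∀ j : ℕ, ∃ R', IsResolvent (((((j * (m : ℝ)⁻¹ : ℝ) : ℂ) • D : E →L[ℂ] E) :
      E →ₗ[ℂ] E) +ᵥ T) z R' := by
    intro j
    induction j with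
    | zero => exact ⟨R, by simpa using h⟩
    | succ j ih =>
      obtain ⟨R₁, hR₁⟩ := ih
      have hs : ∀ f : (((((j * (m : ℝ)⁻¹ : ℝ) : ℂ) • D : E →L[ℂ] E) : E →ₗ[ℂ] E) +ᵥ T).domain,
          (inner ℂ (f : E)
          ((((((j * (m : ℝ)⁻¹ : ℝ) : ℂ) • D : E →L[ℂ] E) : E →ₗ[ℂ] E) +ᵥ T) f)).im = 0 := by
        intro f
        rw [LinearPMap.vadd_apply, inner_add_right, Complex.add_im]
        rw [ContinuousLinearMap.coe_coe, hreal, hT, add_zero]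
      have hn := hR₁.norm_le_of_symmetric hz hs
      obtain ⟨R₂, hR₂⟩ := hR₁.exists_of_norm_mul_lt_one D'
        ((mul_le_mul_of_nonneg_left hn (norm_nonneg _)).trans_lt hD'n)
      refine ⟨R₂, ?_⟩
      rw [← add_vadd] at hR₂
      convert hR₂ using 2
      rw [← ContinuousLinearMap.toLinearMap_add, hD', ← add_smul]
      congr 2
      push_cast
      ring
  obtain ⟨R', hR'⟩ := key m
  refine ⟨R', ?_⟩
  rw [mul_inv_cancel₀ hm0.ne'] at hR'
  simpa using hR'

end Symmetric

/-! ### Multiplication operators on spinors -/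

section Multiplication

variable {n N : ℕ}

theorem norm_toEuclideanCLM_le {A : Matrix (Fin N) (Fin N) ℂ} {c : ℝ}
    (h : ∀ l m, ‖A l m‖ ≤ c) (v : EuclideanSpace ℂ (Fin N)) :
    ‖Matrix.toEuclideanCLM (𝕜 := ℂ) A v‖ ≤ N * c * ‖v‖ := by
  rcases Nat.eq_zero_or_pos N with rfl | hN
  · rw [Subsingleton.elim v 0]; simp
  have hc : 0 ≤ c := (norm_nonneg _).trans (h ⟨0, hN⟩ ⟨0, hN⟩)
  have h1 : (∑ m, ‖v m‖) ^ 2 ≤ N * ‖v‖ ^ 2 := by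
    rw [EuclideanSpace.norm_sq_eq]
    simpa using sq_sum_le_card_mul_sum_sq (s := Finset.univ) (f := fun m => ‖v m‖)
  have h2 : ∀ l, ‖Matrix.toEuclideanCLM (𝕜 := ℂ) A v l‖ ^ 2 ≤ c ^ 2 * (N * ‖v‖ ^ 2) := fun l => by
    have h3 : ‖Matrix.toEuclideanCLM (𝕜 := ℂ) A v l‖ ≤ c * ∑ m, ‖v m‖ := by
      rw [Matrix.ofLp_toEuclideanCLM, Matrix.mulVec, dotProduct, Finset.mul_sum]
      refine (norm_sum_le _ _).trans (Finset.sum_le_sum fun m _ => ?_)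
      rw [norm_mul]
      exact mul_le_mul_of_nonneg_right (h l m) (norm_nonneg _)
    calc _ ≤ (c * ∑ m, ‖v m‖) ^ 2 := by gcongr
      _ = c ^ 2 * (∑ m, ‖v m‖) ^ 2 := by ring
      _ ≤ _ := by gcongr
  refine le_of_sq_le_sq ?_ (by positivity)
  rw [EuclideanSpace.norm_sq_eq]
  refine (Finset.sum_le_sum fun l _ => h2 l).trans (le_of_eq ?_)
  simp
  ring

theorem norm_apply_le_norm_toEuclideanCLM (A : Matrix (Fin N) (Fin N) ℂ) {c : ℝ}
    (h : ∀ v, ‖Matrix.toEuclideanCLM (𝕜 := ℂ) A v‖ ≤ c * ‖v‖) (l m : Fin N) : ‖A l m‖ ≤ c := by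
  have h1 := h (EuclideanSpace.single m 1)
  have h2 := PiLp.norm_apply_le (Matrix.toEuclideanCLM (𝕜 := ℂ) A (EuclideanSpace.single m 1)) l
  rw [Matrix.ofLp_toEuclideanCLM] at h2
  simp at h1 h2
  exact h2.trans h1

variable {V : EuclideanSpace ℝ (Fin n) → Matrix (Fin N) (Fin N) ℂ}

theorem mulOp_ae (hV : ∀ l m, MemLp (fun x => V x l m) ∞ volume) (f : SpinorL2 n N) :
    mulOp V hV f =ᵐ[volume] fun x => Matrix.toEuclideanCLM (𝕜 := ℂ) (V x) (f x) :=
  (memLp_matrix_mulVec hV f).coeFn_toLp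

theorem norm_mulOp_le (hV : ∀ l m, MemLp (fun x => V x l m) ∞ volume) {c : ℝ}
    (h : ∀ᵐ x, ∀ v, ‖Matrix.toEuclideanCLM (𝕜 := ℂ) (V x) v‖ ≤ c * ‖v‖) (f : SpinorL2 n N) :
    ‖mulOp V hV f‖ ≤ c * ‖f‖ := by
  refine Lp.norm_le_mul_norm_of_ae_le_mul ?_
  filter_upwards [h, mulOp_ae hV f] with x hx hx'
  rw [hx']
  exact hx _

theorem exists_norm_mulOp_le (hV : ∀ l m, MemLp (fun x => V x l m) ∞ volume) :
    ∃ c : ℝ, ∀ f : SpinorL2 n N, ‖mulOp V hV f‖ ≤ c * ‖f‖ := by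
  have h : ∀ l m, ∃ c : ℝ, ∀ᵐ x, ‖V x l m‖ ≤ c := fun l m => by
    have h1 := (hV l m).eLpNorm_lt_top
    rw [eLpNorm_exponent_top] at h1
    refine ⟨(eLpNormEssSup (fun x => V x l m) volume).toReal, ?_⟩
    filter_upwards [ae_le_eLpNormEssSup (f := fun x => V x l m) (μ := volume)] with x hx
    rw [← ENNReal.ofReal_le_ofReal_iff ENNReal.toReal_nonneg, ENNReal.ofReal_toReal h1.ne,
      ofReal_norm]
    exact hx
  choose c hc using h
  refine ⟨N * ∑ l, ∑ m, |c l m|, norm_mulOp_le hV ?_⟩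
  have hc' : ∀ᵐ x, ∀ l m, ‖V x l m‖ ≤ c l m := ae_all_iff.mpr fun l => ae_all_iff.mpr fun m => hc l m
  filter_upwards [hc'] with x hx
  refine norm_toEuclideanCLM_le fun l m => (hx l m).trans ((le_abs_self _).trans ?_)
  refine le_trans ?_ (Finset.single_le_sum (f := fun l => ∑ m, |c l m|)
    (fun i _ => Finset.sum_nonneg fun _ _ => abs_nonneg _) (Finset.mem_univ l))
  exact Finset.single_le_sum (f := fun m => |c l m|) (fun _ _ => abs_nonneg _) (Finset.mem_univ m)

/-- Multiplication by a bounded matrix-valued function as a bounded operator. -/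
noncomputable def mulCLM (V : EuclideanSpace ℝ (Fin n) → Matrix (Fin N) (Fin N) ℂ)
    (hV : ∀ l m, MemLp (fun x => V x l m) ∞ volume) : SpinorL2 n N →L[ℂ] SpinorL2 n N :=
  (mulOp V hV).mkContinuousOfExistsBound (exists_norm_mulOp_le hV)

theorem coe_mulCLM (hV : ∀ l m, MemLp (fun x => V x l m) ∞ volume) :
    (mulCLM V hV : SpinorL2 n N →ₗ[ℂ] SpinorL2 n N) = mulOp V hV := rfl

theorem mulCLM_ae (hV : ∀ l m, MemLp (fun x => V x l m) ∞ volume) (f : SpinorL2 n N) :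
    mulCLM V hV f =ᵐ[volume] fun x => Matrix.toEuclideanCLM (𝕜 := ℂ) (V x) (f x) :=
  mulOp_ae hV f

/-- Multiplication by a bounded scalar function as a bounded operator. -/
noncomputable def smulCLM {φ : EuclideanSpace ℝ (Fin n) → ℂ} (hφ : MemLp φ ∞ volume) :
    SpinorL2 n N →L[ℂ] SpinorL2 n N :=
  (ContinuousLinearMap.lsmul ℂ ℂ).holderL volume ∞ 2 2 (hφ.toLp φ)

theorem smulCLM_ae {φ : EuclideanSpace ℝ (Fin n) → ℂ} (hφ : MemLp φ ∞ volume)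
    (f : SpinorL2 n N) : smulCLM hφ f =ᵐ[volume] fun x => φ x • f x := by
  have h := (ContinuousLinearMap.lsmul ℂ ℂ (E := EuclideanSpace ℂ (Fin N))).coeFn_holder
    (μ := volume) (r := 2) (hφ.toLp φ) f
  filter_upwards [h, hφ.coeFn_toLp] with x h1 h2
  refine Eq.trans h1 ?_
  rw [h2]
  rfl

theorem norm_smulCLM_le {φ : EuclideanSpace ℝ (Fin n) → ℂ} (hφ : MemLp φ ∞ volume) {c : ℝ}
    (hc : 0 ≤ c) (h : ∀ᵐ x, ‖φ x‖ ≤ c) :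
    ‖(smulCLM hφ : SpinorL2 n N →L[ℂ] SpinorL2 n N)‖ ≤ c := by
  refine ContinuousLinearMap.opNorm_le_bound _ hc fun f => ?_
  refine Lp.norm_le_mul_norm_of_ae_le_mul ?_
  filter_upwards [h, smulCLM_ae hφ f] with x hx hx'
  rw [hx', norm_smul]
  exact mul_le_mul_of_nonneg_right hx (norm_nonneg _)

theorem smulCLM_mul_smulCLM {φ ψ θ : EuclideanSpace ℝ (Fin n) → ℂ} (hφ : MemLp φ ∞ volume)
    (hψ : MemLp ψ ∞ volume) (hθ : MemLp θ ∞ volume) (h : ∀ᵐ x, φ x * ψ x = θ x) :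
    (smulCLM hφ : SpinorL2 n N →L[ℂ] SpinorL2 n N) * smulCLM hψ = smulCLM hθ := by
  ext1 f
  rw [mul_apply_eq_comp]
  refine Lp.ext ?_
  filter_upwards [h, smulCLM_ae hφ (smulCLM hψ f), smulCLM_ae hψ f, smulCLM_ae hθ f] with
    x h1 h2 h3 h4
  rw [h2, h3, h4, smul_smul, h1]

theorem smulCLM_mul_mulCLM {φ : EuclideanSpace ℝ (Fin n) → ℂ} (hφ : MemLp φ ∞ volume)
    {U V : EuclideanSpace ℝ (Fin n) → Matrix (Fin N) (Fin N) ℂ}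
    (hU : ∀ l m, MemLp (fun x => U x l m) ∞ volume)
    (hV : ∀ l m, MemLp (fun x => V x l m) ∞ volume) (h : ∀ᵐ x, φ x • U x = V x) :
    smulCLM hφ * mulCLM U hU = mulCLM V hV := by
  ext1 f
  rw [mul_apply_eq_comp]
  refine Lp.ext ?_
  filter_upwards [h, smulCLM_ae hφ (mulCLM U hU f), mulCLM_ae hU f, mulCLM_ae hV f] with
    x h1 h2 h3 h4
  rw [h2, h3, h4, ← h1, map_smul, smul_apply]

theorem smulCLM_mulCLM_comm {φ : EuclideanSpace ℝ (Fin n) → ℂ} (hφ : MemLp φ ∞ volume)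
    {U : EuclideanSpace ℝ (Fin n) → Matrix (Fin N) (Fin N) ℂ}
    (hU : ∀ l m, MemLp (fun x => U x l m) ∞ volume) :
    smulCLM hφ * mulCLM U hU = mulCLM U hU * smulCLM hφ := by
  ext1 f
  rw [mul_apply_eq_comp, mul_apply_eq_comp]
  refine Lp.ext ?_
  filter_upwards [smulCLM_ae hφ (mulCLM U hU f), mulCLM_ae hU f, smulCLM_ae hφ f,
    mulCLM_ae hU (smulCLM hφ f)] with x h2 h3 h4 h5
  rw [h2, h3, h5, h4, map_smul]

theorem norm_mulCLM_le (hV : ∀ l m, MemLp (fun x => V x l m) ∞ volume) {c : ℝ} (hc : 0 ≤ c)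
    (h : ∀ᵐ x, ∀ v, ‖Matrix.toEuclideanCLM (𝕜 := ℂ) (V x) v‖ ≤ c * ‖v‖) :
    ‖mulCLM V hV‖ ≤ c :=
  ContinuousLinearMap.opNorm_le_bound _ hc fun f => norm_mulOp_le hV h f

theorem inner_im_eq_zero_of_ae {f g : SpinorL2 n N}
    (h : ∀ᵐ x, (inner ℂ (f x) (g x)).im = 0) : (inner ℂ f g).im = 0 := by
  rw [L2.inner_def, ← Complex.conj_eq_iff_im, ← integral_conj]
  refine integral_congr_ae ?_
  filter_upwards [h] with x hx
  exact Complex.conj_eq_iff_im.mpr hx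

theorem inner_toEuclideanCLM_im {A : Matrix (Fin N) (Fin N) ℂ} (hA : A.IsHermitian)
    (v : EuclideanSpace ℂ (Fin N)) :
    (inner ℂ v (Matrix.toEuclideanCLM (𝕜 := ℂ) A v)).im = 0 := by
  have h : star (Matrix.toEuclideanCLM (𝕜 := ℂ) A) = Matrix.toEuclideanCLM (𝕜 := ℂ) A := by
    rw [← map_star]
    exact congrArg _ hA
  rw [← Complex.conj_eq_iff_im, inner_conj_symm, ← ContinuousLinearMap.adjoint_inner_right,
    ← ContinuousLinearMap.star_eq_adjoint, h]

theorem inner_mulCLM_im (hV : ∀ l m, MemLp (fun x => V x l m) ∞ volume)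
    (h : ∀ᵐ x, (V x).IsHermitian) (f : SpinorL2 n N) : (inner ℂ f (mulCLM V hV f)).im = 0 := by
  refine inner_im_eq_zero_of_ae ?_
  filter_upwards [h, mulCLM_ae hV f] with x hx hx'
  rw [hx']
  exact inner_toEuclideanCLM_im hx _

end Multiplication

/-! ### Derivatives, constant matrices and translations under the Fourier transform -/

section FourierSide

open FourierTransform

variable {n N : ℕ}

theorem spinor_toTempered_injective {f g : SpinorL2 n N}
    (h : (f : 𝓢'(EuclideanSpace ℝ (Fin n), EuclideanSpace ℂ (Fin N))) = g) : f = g :=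
  LinearMap.ker_eq_bot.mp (Lp.ker_toTemperedDistributionCLM_eq_bot
    (F := EuclideanSpace ℂ (Fin N)) (μ := (volume : Measure (EuclideanSpace ℝ (Fin n))))
    (p := 2)) h

theorem smulLeftCLM_toTempered_eq_iff {φ : EuclideanSpace ℝ (Fin n) → ℂ}
    (hφ : φ.HasTemperateGrowth) (u v : SpinorL2 n N) :
    TemperedDistribution.smulLeftCLM (EuclideanSpace ℂ (Fin N)) φ
      (u : 𝓢'(EuclideanSpace ℝ (Fin n), EuclideanSpace ℂ (Fin N))) = v ↔
    v =ᵐ[volume] fun x => φ x • u x := by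
  constructor
  · intro h
    -- `φ` may grow, so φu is only known to be locally integrable; the two sides are therefore
    -- compared against compactly supported smooth functions.
    have hu : LocallyIntegrable u volume := (Lp.memLp u).locallyIntegrable (by norm_num)
    have hv : LocallyIntegrable v volume := (Lp.memLp v).locallyIntegrable (by norm_num)
    have hφu : LocallyIntegrable (fun x => φ x • u x) volume :=
      hu.continuous_smul hφ.1.continuous
    have h0 : ∀ᵐ x, v x - φ x • u x = 0 := by
      refine ae_eq_zero_of_integral_contDiff_smul_eq_zero (hv.sub hφu) fun g hg1 hg2 => ?_
      have hg₁ : HasCompactSupport (Complex.ofRealCLM ∘ g) := hg2.comp_left rfl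
      have hg₂ : ContDiff ℝ (⊤ : ℕ∞) (Complex.ofRealCLM ∘ g) := by fun_prop
      have h1 := congrArg (fun T => T (hg₁.toSchwartzMap hg₂)) h
      simp only [TemperedDistribution.smulLeftCLM_apply_apply, Lp.toTemperedDistribution_apply,
        SchwartzMap.smulLeftCLM_apply_apply hφ] at h1
      have h2 : ∫ x, g x • v x = ∫ x, g x • (φ x • u x) := by
        refine Eq.trans ?_ (h1.symm.trans ?_)
        · refine integral_congr_ae (Filter.Eventually.of_forall fun x => ?_)
          simp
        · refine integral_congr_ae (Filter.Eventually.of_forall fun x => ?_)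
          simp [mul_comm (φ x), mul_smul]
      simp only [smul_sub]
      rw [integral_sub, h2, sub_self]
      · exact hv.integrable_smul_left_of_hasCompactSupport hg1.continuous hg2
      · exact hφu.integrable_smul_left_of_hasCompactSupport hg1.continuous hg2
    filter_upwards [h0] with x hx
    exact sub_eq_zero.mp hx
  · intro h
    ext ψ : 1
    simp only [TemperedDistribution.smulLeftCLM_apply_apply, Lp.toTemperedDistribution_apply,
      SchwartzMap.smulLeftCLM_apply_apply hφ]
    refine integral_congr_ae ?_
    filter_upwards [h] with x hx
    rw [hx, smul_smul, smul_eq_mul, mul_comm]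

/-- Turns membership in the Sobolev space into square integrability of ξ_j times the transform. The
factor 2π comes from the normalisation e^(-2πi x·ξ). -/
theorem hasWeakPartial_iff_fourier {j : Fin n} {f g : SpinorL2 n N} :
    HasWeakPartial j f g ↔
      (𝓕 g : SpinorL2 n N) =ᵐ[volume] fun ξ => (2 * Real.pi * Complex.I * ξ j) • (𝓕 f : SpinorL2 n N) ξ := by
  have hj : Function.HasTemperateGrowth
      fun ξ : EuclideanSpace ℝ (Fin n) => (2 * Real.pi * Complex.I * ξ j : ℂ) := by
    have h1 : Function.HasTemperateGrowth fun ξ : EuclideanSpace ℝ (Fin n) => ((inner ℝ ξ (EuclideanSpace.single j (1 : ℝ)) : ℝ) : ℂ) := by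
      fun_prop
    have h2 := (Function.HasTemperateGrowth.const (E := EuclideanSpace ℝ (Fin n)) (2 * Real.pi * Complex.I : ℂ)).mul h1
    refine (congrArg Function.HasTemperateGrowth (funext fun ξ => ?_)).mp h2
    simp [EuclideanSpace.inner_single_right]
  rw [← smulLeftCLM_toTempered_eq_iff hj, ← Lp.fourier_toTemperedDistribution_eq,
    ← Lp.fourier_toTemperedDistribution_eq]
  have h2 : 𝓕 (∂_{EuclideanSpace.single j (1 : ℝ)}
      (f : 𝓢'(EuclideanSpace ℝ (Fin n), EuclideanSpace ℂ (Fin N)))) =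
      TemperedDistribution.smulLeftCLM (EuclideanSpace ℂ (Fin N))
        (fun ξ : EuclideanSpace ℝ (Fin n) => (2 * Real.pi * Complex.I * ξ j : ℂ))
        (𝓕 (f : 𝓢'(EuclideanSpace ℝ (Fin n), EuclideanSpace ℂ (Fin N)))) := by
    rw [TemperedDistribution.fourier_lineDerivOp_eq, ← smul_apply,
      ← TemperedDistribution.smulLeftCLM_smul (by fun_prop)]
    congr 2
    ext ξ
    simp [EuclideanSpace.inner_single_right]
  rw [← h2]
  constructor
  · intro h
    rw [h]
  · intro h
    have := congrArg 𝓕⁻ h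
    rwa [fourierInv_fourier_eq, fourierInv_fourier_eq] at this

theorem fourier_compLpL (A : EuclideanSpace ℂ (Fin N) →L[ℂ] EuclideanSpace ℂ (Fin N))
    (f : SpinorL2 n N) : (𝓕 (A.compLpL 2 volume f) : SpinorL2 n N) = A.compLpL 2 volume (𝓕 f) := by
  have h : ∀ (u : SpinorL2 n N) (ψ : 𝓢(EuclideanSpace ℝ (Fin n), ℂ)),
      ((A.compLpL 2 volume u : SpinorL2 n N) : 𝓢'(EuclideanSpace ℝ (Fin n), EuclideanSpace ℂ (Fin N))) ψ =
      A ((u : 𝓢'(EuclideanSpace ℝ (Fin n), EuclideanSpace ℂ (Fin N))) ψ) := fun u ψ => by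
    rw [Lp.toTemperedDistribution_apply, Lp.toTemperedDistribution_apply,
      ← ContinuousLinearMap.integral_comp_comm]
    · refine integral_congr_ae ?_
      filter_upwards [A.coeFn_compLpL (p := 2) (μ := volume) u] with x hx
      rw [hx, map_smul]
    · exact memLp_one_iff_integrable.mp ((Lp.memLp u).smul (ψ.memLp 2 volume))
  refine spinor_toTempered_injective ?_
  ext ψ : 1
  rw [← Lp.fourier_toTemperedDistribution_eq, TemperedDistribution.fourier_apply, h, h,
    ← Lp.fourier_toTemperedDistribution_eq, TemperedDistribution.fourier_apply]

/-- The translate `x ↦ f (x + y)`. -/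
noncomputable def spinorTranslate (y : EuclideanSpace ℝ (Fin n)) :
    SpinorL2 n N →ₗᵢ[ℂ] SpinorL2 n N :=
  Lp.compMeasurePreservingₗᵢ ℂ (fun x => x + y) (measurePreserving_add_right volume y)

theorem spinorTranslate_ae (y : EuclideanSpace ℝ (Fin n)) (f : SpinorL2 n N) :
    spinorTranslate y f =ᵐ[volume] fun x => f (x + y) :=
  Lp.coeFn_compMeasurePreserving f (measurePreserving_add_right volume y)

/-- Both sides are continuous in `f`, so it suffices to check Schwartz functions, where the integral
formula applies. -/
theorem fourier_spinorTranslate_ae (y : EuclideanSpace ℝ (Fin n)) (f : SpinorL2 n N) :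
    (𝓕 (spinorTranslate y f) : SpinorL2 n N) =ᵐ[volume]
      fun ξ => (Real.fourierChar (inner ℝ y ξ) : ℂ) • (𝓕 f : SpinorL2 n N) ξ := by
  have hm : MemLp (fun ξ : EuclideanSpace ℝ (Fin n) => (Real.fourierChar (inner ℝ y ξ) : ℂ)) ∞
      volume := by
    refine memLp_top_of_bound ?_ 1 (Filter.Eventually.of_forall fun ξ => (Circle.norm_coe _).le)
    exact (Continuous.aestronglyMeasurable (by fun_prop))
  have key : (𝓕 (spinorTranslate y f) : SpinorL2 n N) = smulCLM hm (𝓕 f) := by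
    refine DenseRange.induction_on
      (p := fun f : SpinorL2 n N => (𝓕 (spinorTranslate y f) : SpinorL2 n N) = smulCLM hm (𝓕 f))
      (SchwartzMap.denseRange_toLpCLM (p := 2) ENNReal.ofNat_ne_top) f ?_ ?_
    · refine isClosed_eq ?_ ?_
      · exact (Lp.fourierTransformₗᵢ _ _).continuous.comp (spinorTranslate y).continuous
      · exact (smulCLM hm).continuous.comp (Lp.fourierTransformₗᵢ _ _).continuous
    · intro g
      have h1 : spinorTranslate y (g.toLp 2 : SpinorL2 n N) =
          (SchwartzMap.compSubConstCLM ℂ (-y) g).toLp 2 := by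
        refine Lp.ext ?_
        filter_upwards [spinorTranslate_ae y (g.toLp 2 : SpinorL2 n N),
          (SchwartzMap.compSubConstCLM ℂ (-y) g).coeFn_toLp 2 volume,
          (measurePreserving_add_right volume y).quasiMeasurePreserving.ae
            (g.coeFn_toLp 2 volume)] with x h2 h3 h4
        rw [h2, h3, h4]
        simp
      change 𝓕 (spinorTranslate y (g.toLp 2 : SpinorL2 n N)) = smulCLM hm (𝓕 (g.toLp 2 : SpinorL2 n N))
      rw [h1, SchwartzMap.toLp_fourier_eq, SchwartzMap.toLp_fourier_eq]
      refine Lp.ext ?_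
      filter_upwards [smulCLM_ae hm ((𝓕 g).toLp 2 : SpinorL2 n N), (𝓕 g).coeFn_toLp 2 volume,
        (𝓕 (SchwartzMap.compSubConstCLM ℂ (-y) g)).coeFn_toLp 2 volume] with ξ h2 h3 h4
      rw [h2, h3, h4, SchwartzMap.fourier_coe, SchwartzMap.fourier_coe]
      have h5 := congrFun (VectorFourier.fourierIntegral_comp_add_right Real.fourierChar volume
        (innerₗ (EuclideanSpace ℝ (Fin n))) g y) ξ
      have h6 : (SchwartzMap.compSubConstCLM ℂ (-y) g : EuclideanSpace ℝ (Fin n) → _) =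
          g ∘ fun v => v + y := by
        ext1 x; simp
      rw [h6]
      exact h5
  rw [key]
  exact smulCLM_ae hm _

end FourierSide

/-! ### The free Dirac operator and its resolvent as Fourier multipliers -/

section FreeDirac

open FourierTransform

variable {n N : ℕ} {α : Fin (n + 1) → Matrix (Fin N) (Fin N) ℂ}

/-- The symbol `∑ⱼ 2π ξⱼ αⱼ` of the free Dirac operator. -/
noncomputable def diracSymbol (α : Fin (n + 1) → Matrix (Fin N) (Fin N) ℂ)
    (ξ : EuclideanSpace ℝ (Fin n)) : Matrix (Fin N) (Fin N) ℂ :=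
  ∑ j : Fin n, ((2 * Real.pi * ξ j : ℝ) : ℂ) • α j.castSucc

theorem IsDiracFamily.isHermitian_sum (hα : IsDiracFamily α) (c : Fin n → ℝ) :
    (∑ j : Fin n, ((c j : ℝ) : ℂ) • α j.castSucc).IsHermitian := by
  rw [Matrix.IsHermitian, Matrix.conjTranspose_sum]
  refine Finset.sum_congr rfl fun j _ => ?_
  rw [Matrix.conjTranspose_smul, (hα.1 _).eq]
  simp

/-- Adding the double sum to its transpose leaves only anticommutators, whose off-diagonal terms
vanish. -/
theorem IsDiracFamily.sum_mul_self (hα : IsDiracFamily α) (c : Fin n → ℝ) :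
    (∑ j : Fin n, ((c j : ℝ) : ℂ) • α j.castSucc) * (∑ j : Fin n, ((c j : ℝ) : ℂ) • α j.castSucc) =
      ((∑ j, c j ^ 2 : ℝ) : ℂ) • 1 := by
  set S := ∑ j : Fin n, ((c j : ℝ) : ℂ) • α j.castSucc with hS
  have h1 : S * S = ∑ j, ∑ k, ((c j : ℂ) * c k) • (α j.castSucc * α k.castSucc) := by
    rw [hS, Finset.sum_mul_sum]
    refine Finset.sum_congr rfl fun j _ => Finset.sum_congr rfl fun k _ => ?_
    rw [smul_mul_smul_comm]
  have h2 : S * S = ∑ j, ∑ k, ((c j : ℂ) * c k) • (α k.castSucc * α j.castSucc) := by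
    rw [h1, Finset.sum_comm]
    refine Finset.sum_congr rfl fun j _ => Finset.sum_congr rfl fun k _ => ?_
    rw [mul_comm (c k : ℂ)]
  have h3 : S * S + S * S = (2 : ℂ) • (((∑ j, c j ^ 2 : ℝ) : ℂ) • 1) := by
    nth_rw 1 [h1]
    rw [h2, ← Finset.sum_add_distrib]
    have h4 : ∀ j : Fin n, ∑ k : Fin n, ((c j : ℂ) * c k) • (α j.castSucc * α k.castSucc) +
        ∑ k : Fin n, ((c j : ℂ) * c k) • (α k.castSucc * α j.castSucc) =
        (2 * (c j : ℂ) ^ 2) • 1 := fun j => by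
      rw [← Finset.sum_add_distrib, Finset.sum_eq_single j]
      · rw [← smul_add, hα.2, if_pos rfl, smul_smul]
        congr 1
        ring
      · intro k _ hk
        rw [← smul_add, hα.2, if_neg, smul_zero]
        exact fun h => hk (Fin.castSucc_injective n h).symm
      · simp
    rw [Finset.sum_congr rfl fun j _ => h4 j, ← Finset.sum_smul, smul_smul]
    push_cast
    rw [Finset.mul_sum]
  rw [← two_smul ℂ] at h3
  exact smul_right_injective _ (two_ne_zero : (2 : ℂ) ≠ 0) h3

theorem IsDiracFamily.isHermitian_diracSymbol (hα : IsDiracFamily α)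
    (ξ : EuclideanSpace ℝ (Fin n)) : (diracSymbol α ξ).IsHermitian :=
  hα.isHermitian_sum _

theorem IsDiracFamily.diracSymbol_mul_self (hα : IsDiracFamily α)
    (ξ : EuclideanSpace ℝ (Fin n)) :
    diracSymbol α ξ * diracSymbol α ξ = (((2 * Real.pi * ‖ξ‖) ^ 2 : ℝ) : ℂ) • 1 := by
  rw [diracSymbol, hα.sum_mul_self, mul_pow, EuclideanSpace.norm_sq_eq, Finset.mul_sum]
  have h : ∀ j, (2 * Real.pi * ξ j) ^ 2 = (2 * Real.pi) ^ 2 * ‖ξ j‖ ^ 2 := fun j => by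
    rw [mul_pow, Real.norm_eq_abs, sq_abs]
  simp only [h]

theorem IsDiracFamily.norm_sum_apply (hα : IsDiracFamily α) (c : Fin n → ℝ)
    (v : EuclideanSpace ℂ (Fin N)) :
    ‖Matrix.toEuclideanCLM (𝕜 := ℂ) (∑ j : Fin n, ((c j : ℝ) : ℂ) • α j.castSucc) v‖ ^ 2 =
      (∑ j, c j ^ 2) * ‖v‖ ^ 2 := by
  set S := ∑ j : Fin n, ((c j : ℝ) : ℂ) • α j.castSucc with hS
  have h : star (Matrix.toEuclideanCLM (𝕜 := ℂ) S) = Matrix.toEuclideanCLM (𝕜 := ℂ) S := by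
    rw [← map_star]
    exact congrArg _ (hα.isHermitian_sum c)
  have h1 : inner ℂ (Matrix.toEuclideanCLM (𝕜 := ℂ) S v) (Matrix.toEuclideanCLM (𝕜 := ℂ) S v) =
      ((∑ j, c j ^ 2 : ℝ) : ℂ) * inner ℂ v v := by
    rw [← ContinuousLinearMap.adjoint_inner_right, ← ContinuousLinearMap.star_eq_adjoint, h,
      ← mul_apply_eq_comp, ← map_mul, hα.sum_mul_self, map_smul, map_one, smul_apply,
      one_apply_eq_self, inner_smul_right]
  rw [inner_self_eq_norm_sq_to_K, inner_self_eq_norm_sq_to_K] at h1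
  have h2 : ((‖Matrix.toEuclideanCLM (𝕜 := ℂ) S v‖ ^ 2 : ℝ) : ℂ) =
      (((∑ j, c j ^ 2) * ‖v‖ ^ 2 : ℝ) : ℂ) := by
    push_cast at h1 ⊢
    exact h1
  exact Complex.ofReal_injective h2

theorem IsDiracFamily.norm_diracSymbol_apply (hα : IsDiracFamily α)
    (ξ : EuclideanSpace ℝ (Fin n)) (v : EuclideanSpace ℂ (Fin N)) :
    ‖Matrix.toEuclideanCLM (𝕜 := ℂ) (diracSymbol α ξ) v‖ = 2 * Real.pi * ‖ξ‖ * ‖v‖ := by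
  refine (sq_eq_sq₀ (norm_nonneg _) (by positivity)).mp ?_
  rw [diracSymbol, hα.norm_sum_apply, mul_pow, mul_pow _ ‖ξ‖, EuclideanSpace.norm_sq_eq ξ,
    Finset.mul_sum]
  congr 1
  refine Finset.sum_congr rfl fun j _ => ?_
  rw [mul_pow, Real.norm_eq_abs, sq_abs]

theorem weakPartial_spec (j : Fin n) (f : sobolevW12 n N) :
    HasWeakPartial j (f : SpinorL2 n N) (weakPartial j f) :=
  (f.2 j).choose_spec

theorem freeDirac_apply {f : SpinorL2 n N} (hf : f ∈ sobolevW12 n N)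
    (hf' : f ∈ (freeDirac α).domain) :
    freeDirac α ⟨f, hf'⟩ = ∑ j : Fin n, (Matrix.toEuclideanCLM (𝕜 := ℂ) (α j.castSucc)).compLpL 2
      (volume : Measure (EuclideanSpace ℝ (Fin n))) ((-Complex.I) • weakPartial j ⟨f, hf⟩) := by
  exact LinearMap.sum_apply Finset.univ (fun j : Fin n =>
    (((Matrix.toEuclideanCLM (𝕜 := ℂ) (α j.castSucc)).compLpL 2
      (volume : Measure (EuclideanSpace ℝ (Fin n))) : SpinorL2 n N →L[ℂ] SpinorL2 n N) :
        SpinorL2 n N →ₗ[ℂ] SpinorL2 n N) ∘ₗ ((-Complex.I) • weakPartial j))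
    ⟨f, hf⟩

theorem fourier_finset_sum {ι : Type*} (s : Finset ι) (f : ι → SpinorL2 n N) :
    (𝓕 (∑ i ∈ s, f i) : SpinorL2 n N) = ∑ i ∈ s, 𝓕 (f i) :=
  map_sum (Lp.fourierTransformₗᵢ (EuclideanSpace ℝ (Fin n)) (EuclideanSpace ℂ (Fin N))) f s

theorem coeFn_finset_sum {ι : Type*} (s : Finset ι) (f : ι → SpinorL2 n N) :
    (∑ i ∈ s, f i : SpinorL2 n N) =ᵐ[volume] fun x => ∑ i ∈ s, f i x := by
  classical
  induction s using Finset.induction_on with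
  | empty => exact Lp.coeFn_zero _ _ _
  | insert i s hi ih =>
    rw [Finset.sum_insert hi]
    filter_upwards [Lp.coeFn_add (f i) (∑ i ∈ s, f i), ih] with x h1 h2
    rw [h1, Pi.add_apply, h2, Finset.sum_insert hi]

theorem fourier_freeDirac_ae (f : (freeDirac α).domain) :
    (𝓕 (freeDirac α f) : SpinorL2 n N) =ᵐ[volume] fun ξ =>
      Matrix.toEuclideanCLM (𝕜 := ℂ) (diracSymbol α ξ) ((𝓕 (f : SpinorL2 n N) : SpinorL2 n N) ξ) := by
  obtain ⟨f, hf⟩ := f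
  have hf' : f ∈ sobolevW12 n N := hf
  rw [freeDirac_apply hf' hf, fourier_finset_sum]
  have h : ∀ j : Fin n, ∀ᵐ ξ, (𝓕 ((Matrix.toEuclideanCLM (𝕜 := ℂ) (α j.castSucc)).compLpL 2
      (volume : Measure (EuclideanSpace ℝ (Fin n))) ((-Complex.I) • weakPartial j ⟨f, hf'⟩)) : SpinorL2 n N) ξ
      = ((2 * Real.pi * ξ j : ℝ) : ℂ) • Matrix.toEuclideanCLM (𝕜 := ℂ) (α j.castSucc)
        ((𝓕 f : SpinorL2 n N) ξ) := fun j => by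
    rw [fourier_compLpL, FourierTransform.fourier_smul]
    filter_upwards [(Matrix.toEuclideanCLM (𝕜 := ℂ) (α j.castSucc)).coeFn_compLpL (p := 2)
      (μ := (volume : Measure (EuclideanSpace ℝ (Fin n)))) ((-Complex.I) • 𝓕 (weakPartial j ⟨f, hf'⟩)),
      Lp.coeFn_smul (-Complex.I) (𝓕 (weakPartial j ⟨f, hf'⟩) : SpinorL2 n N),
      hasWeakPartial_iff_fourier.mp (weakPartial_spec j ⟨f, hf'⟩)] with ξ h1 h2 h3
    rw [h1, h2, Pi.smul_apply, h3, smul_smul, map_smul]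
    congr 1
    push_cast
    linear_combination (-2 * Real.pi * ξ j) * Complex.I_mul_I
  filter_upwards [coeFn_finset_sum Finset.univ fun j : Fin n =>
    (𝓕 ((Matrix.toEuclideanCLM (𝕜 := ℂ) (α j.castSucc)).compLpL 2
      (volume : Measure (EuclideanSpace ℝ (Fin n))) ((-Complex.I) • weakPartial j ⟨f, hf'⟩)) : SpinorL2 n N),
    ae_all_iff.mpr h] with ξ h1 h2
  rw [h1, diracSymbol, map_sum, sum_apply]
  refine Finset.sum_congr rfl fun j _ => ?_
  rw [h2, map_smul, smul_apply]

theorem inner_freeDirac_im (hα : IsDiracFamily α) (f : (freeDirac α).domain) :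
    (inner ℂ (f : SpinorL2 n N) (freeDirac α f)).im = 0 := by
  rw [← Lp.inner_fourier_eq]
  refine inner_im_eq_zero_of_ae ?_
  filter_upwards [fourier_freeDirac_ae f] with ξ h
  rw [h]
  exact inner_toEuclideanCLM_im (hα.isHermitian_diracSymbol ξ) _

/-- The symbol of `(H₀ - z)⁻¹`. -/
noncomputable def resolventSymbol (α : Fin (n + 1) → Matrix (Fin N) (Fin N) ℂ) (z : ℂ)
    (ξ : EuclideanSpace ℝ (Fin n)) : Matrix (Fin N) (Fin N) ℂ :=
  ((((2 * Real.pi * ‖ξ‖) ^ 2 : ℝ) : ℂ) - z ^ 2)⁻¹ • (diracSymbol α ξ + z • 1)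

theorem sub_sq_ne_zero {z : ℂ} (hz : z.im ≠ 0) (t : ℝ) : ((t ^ 2 : ℝ) : ℂ) - z ^ 2 ≠ 0 := by
  intro h
  have h1 : ((t : ℂ) - z) * (t + z) = 0 := by
    rw [← h]; push_cast; ring
  rcases mul_eq_zero.mp h1 with h2 | h2
  · exact hz (by simpa using congrArg Complex.im h2)
  · exact hz (by simpa using congrArg Complex.im h2)

/-- With A the symbol, (A - z)(A + z) = A² - z² is the scalar (2π|ξ|)² - z², which is nonzero for
nonreal z. -/
theorem IsDiracFamily.sub_mul_resolventSymbol (hα : IsDiracFamily α) {z : ℂ} (hz : z.im ≠ 0)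
    (ξ : EuclideanSpace ℝ (Fin n)) :
    (diracSymbol α ξ - z • 1) * resolventSymbol α z ξ = 1 := by
  have h0 := sub_sq_ne_zero hz (2 * Real.pi * ‖ξ‖)
  rw [resolventSymbol, mul_smul_comm, inv_smul_eq_iff₀ h0, sub_smul, ← hα.diracSymbol_mul_self,
    mul_add, sub_mul, sub_mul]
  simp only [smul_mul_assoc, one_mul, mul_smul_comm, mul_one]
  rw [sq z, mul_smul]
  abel

theorem IsDiracFamily.resolventSymbol_apply (hα : IsDiracFamily α) {z : ℂ} (hz : z.im ≠ 0)
    (ξ : EuclideanSpace ℝ (Fin n)) (v : EuclideanSpace ℂ (Fin N)) :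
    Matrix.toEuclideanCLM (𝕜 := ℂ) (diracSymbol α ξ)
      (Matrix.toEuclideanCLM (𝕜 := ℂ) (resolventSymbol α z ξ) v) =
      v + z • Matrix.toEuclideanCLM (𝕜 := ℂ) (resolventSymbol α z ξ) v := by
  have h := congrArg (fun A => Matrix.toEuclideanCLM (𝕜 := ℂ) A v)
    (hα.sub_mul_resolventSymbol hz ξ)
  simp only [map_mul, map_sub, map_smul, map_one, mul_apply_eq_comp, sub_apply, smul_apply,
    one_apply_eq_self] at h
  exact sub_eq_iff_eq_add.mp h

/-- The lower bound for symmetric operators, applied to the Hermitian matrix at a single frequency.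
-/
theorem IsDiracFamily.norm_resolventSymbol_apply_le (hα : IsDiracFamily α) {z : ℂ}
    (hz : z.im ≠ 0) (ξ : EuclideanSpace ℝ (Fin n)) (v : EuclideanSpace ℂ (Fin N)) :
    ‖Matrix.toEuclideanCLM (𝕜 := ℂ) (resolventSymbol α z ξ) v‖ ≤ |z.im|⁻¹ * ‖v‖ := by
  set w := Matrix.toEuclideanCLM (𝕜 := ℂ) (resolventSymbol α z ξ) v with hw
  have h1 := norm_sub_smul_ge_of_symmetric (z := z)
    (T := ((Matrix.toEuclideanCLM (𝕜 := ℂ) (diracSymbol α ξ) :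
      EuclideanSpace ℂ (Fin N) →ₗ[ℂ] EuclideanSpace ℂ (Fin N)).toPMap ⊤))
    (fun f => inner_toEuclideanCLM_im (hα.isHermitian_diracSymbol ξ) _) ⟨w, trivial⟩
  have h2 : (((Matrix.toEuclideanCLM (𝕜 := ℂ) (diracSymbol α ξ) :
      EuclideanSpace ℂ (Fin N) →ₗ[ℂ] EuclideanSpace ℂ (Fin N)).toPMap ⊤) ⟨w, trivial⟩) = v + z • w :=
    hα.resolventSymbol_apply hz ξ v
  rw [h2, add_sub_cancel_right] at h1
  rw [inv_mul_eq_div, le_div_iff₀ (abs_pos.mpr hz), mul_comm]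
  exact h1

/-- The symbol acts as 2π|ξ| times an isometry, and symbol times resolvent is 1 + z · resolvent.
This encodes the gain of one derivative. -/
theorem IsDiracFamily.norm_mul_resolventSymbol_apply_le (hα : IsDiracFamily α) {z : ℂ}
    (hz : z.im ≠ 0) (ξ : EuclideanSpace ℝ (Fin n)) (v : EuclideanSpace ℂ (Fin N)) :
    2 * Real.pi * ‖ξ‖ * ‖Matrix.toEuclideanCLM (𝕜 := ℂ) (resolventSymbol α z ξ) v‖ ≤
      (1 + ‖z‖ * |z.im|⁻¹) * ‖v‖ := by
  rw [← hα.norm_diracSymbol_apply, hα.resolventSymbol_apply hz]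
  refine (norm_add_le _ _).trans ?_
  rw [norm_smul, add_mul, one_mul, mul_assoc]
  gcongr
  exact hα.norm_resolventSymbol_apply_le hz ξ v

theorem IsDiracFamily.continuous_resolventSymbol (z : ℂ) (hz : z.im ≠ 0) (l m : Fin N) :
    Continuous fun ξ : EuclideanSpace ℝ (Fin n) => resolventSymbol α z ξ l m := by
  have h : Continuous fun ξ : EuclideanSpace ℝ (Fin n) => resolventSymbol α z ξ := by
    unfold resolventSymbol diracSymbol
    refine Continuous.smul (Continuous.inv₀ (by fun_prop) fun ξ => sub_sq_ne_zero hz _) ?_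
    fun_prop
  fun_prop

theorem IsDiracFamily.memLp_resolventSymbol (hα : IsDiracFamily α) {z : ℂ} (hz : z.im ≠ 0)
    (l m : Fin N) :
    MemLp (fun ξ : EuclideanSpace ℝ (Fin n) => resolventSymbol α z ξ l m) ∞ volume :=
  memLp_top_of_bound (IsDiracFamily.continuous_resolventSymbol z hz l m).aestronglyMeasurable
    |z.im|⁻¹ (Filter.Eventually.of_forall fun ξ =>
      norm_apply_le_norm_toEuclideanCLM _ (hα.norm_resolventSymbol_apply_le hz ξ) l m)

theorem IsDiracFamily.memLp_mul_resolventSymbol (hα : IsDiracFamily α) {z : ℂ} (hz : z.im ≠ 0)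
    (j : Fin n) (l m : Fin N) :
    MemLp (fun ξ : EuclideanSpace ℝ (Fin n) =>
      ((2 * Real.pi * Complex.I * ξ j : ℂ) • resolventSymbol α z ξ) l m) ∞ volume := by
  refine memLp_top_of_bound ?_ (1 + ‖z‖ * |z.im|⁻¹) (Filter.Eventually.of_forall fun ξ => ?_)
  · have := IsDiracFamily.continuous_resolventSymbol (α := α) z hz l m
    simp only [Matrix.smul_apply]
    have h2 : Continuous fun ξ : EuclideanSpace ℝ (Fin n) => (2 * Real.pi * Complex.I * ξ j : ℂ) := by
      fun_prop
    exact (h2.smul this).aestronglyMeasurable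
  · refine norm_apply_le_norm_toEuclideanCLM _ (fun v => ?_) l m
    refine le_trans ?_ (hα.norm_mul_resolventSymbol_apply_le hz ξ v)
    rw [map_smul, smul_apply, norm_smul]
    gcongr
    simp only [norm_mul, Complex.norm_I, Complex.norm_real, RCLike.norm_ofNat, mul_one,
      Real.norm_eq_abs, abs_of_pos Real.pi_pos]
    gcongr
    exact PiLp.norm_apply_le ξ j

/-- The free resolvent `(H₀ - z)⁻¹` as a Fourier multiplier. -/
noncomputable def freeResolvent (hα : IsDiracFamily α) {z : ℂ} (hz : z.im ≠ 0) :
    SpinorL2 n N →L[ℂ] SpinorL2 n N :=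
  ((Lp.fourierTransformₗᵢ (EuclideanSpace ℝ (Fin n)) (EuclideanSpace ℂ (Fin N))).symm :
    SpinorL2 n N →L[ℂ] SpinorL2 n N) ∘L
  (mulCLM (resolventSymbol α z) (hα.memLp_resolventSymbol hz)) ∘L
  ((Lp.fourierTransformₗᵢ (EuclideanSpace ℝ (Fin n)) (EuclideanSpace ℂ (Fin N))) :
    SpinorL2 n N →L[ℂ] SpinorL2 n N)

theorem fourier_freeResolvent_ae (hα : IsDiracFamily α) {z : ℂ} (hz : z.im ≠ 0)
    (f : SpinorL2 n N) : (𝓕 (freeResolvent hα hz f) : SpinorL2 n N) =ᵐ[volume] fun ξ =>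
      Matrix.toEuclideanCLM (𝕜 := ℂ) (resolventSymbol α z ξ) ((𝓕 f : SpinorL2 n N) ξ) := by
  have h : (𝓕 (freeResolvent hα hz f) : SpinorL2 n N) =
      mulCLM (resolventSymbol α z) (hα.memLp_resolventSymbol hz) (𝓕 f) :=
    (Lp.fourierTransformₗᵢ (EuclideanSpace ℝ (Fin n))
      (EuclideanSpace ℂ (Fin N))).apply_symm_apply _
  rw [h]
  exact mulCLM_ae _ _

theorem isResolvent_freeResolvent (hα : IsDiracFamily α) {z : ℂ} (hz : z.im ≠ 0) :
    IsResolvent (freeDirac α) z (freeResolvent hα hz) := by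
  refine IsResolvent.of_right_inverse_of_symmetric hz (inner_freeDirac_im hα) fun f => ?_
  have hmem : freeResolvent hα hz f ∈ (freeDirac α).domain := fun j => by
    refine ⟨𝓕⁻ (mulCLM _ (hα.memLp_mul_resolventSymbol hz j) (𝓕 f)), ?_⟩
    rw [hasWeakPartial_iff_fourier, fourier_fourierInv_eq]
    filter_upwards [mulCLM_ae (hα.memLp_mul_resolventSymbol hz j) (𝓕 f),
      fourier_freeResolvent_ae hα hz f] with ξ h1 h2
    rw [h1, h2, map_smul, smul_apply]
  refine ⟨hmem, ?_⟩
  refine (Lp.fourierTransformₗᵢ (EuclideanSpace ℝ (Fin n))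
    (EuclideanSpace ℂ (Fin N))).injective ?_
  rw [map_sub, map_smul]
  change 𝓕 (freeDirac α ⟨freeResolvent hα hz f, hmem⟩) - z • 𝓕 (freeResolvent hα hz f) = 𝓕 f
  refine Lp.ext ?_
  filter_upwards [Lp.coeFn_sub (𝓕 (freeDirac α ⟨freeResolvent hα hz f, hmem⟩) : SpinorL2 n N)
    (z • 𝓕 (freeResolvent hα hz f)), Lp.coeFn_smul z (𝓕 (freeResolvent hα hz f) : SpinorL2 n N),
    fourier_freeDirac_ae ⟨freeResolvent hα hz f, hmem⟩, fourier_freeResolvent_ae hα hz f]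
    with ξ h1 h2 h3 h4
  rw [h1, Pi.sub_apply, h2, Pi.smul_apply, h3, h4, hα.resolventSymbol_apply hz,
    add_sub_cancel_right]

/-- Translation multiplies the transform by a phase, |e^(iθ) - 1| ≤ |θ| costs one factor 2π|ξ|, and
the resolvent absorbs it. This is the only form in which regularity is used by the cell
approximation. -/
theorem norm_translate_freeResolvent_sub_le (hα : IsDiracFamily α) {z : ℂ} (hz : z.im ≠ 0)
    (y : EuclideanSpace ℝ (Fin n)) (f : SpinorL2 n N) :
    ‖spinorTranslate y (freeResolvent hα hz f) - freeResolvent hα hz f‖ ≤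
      (1 + ‖z‖ * |z.im|⁻¹) * ‖y‖ * ‖f‖ := by
  have hsub : (𝓕 (spinorTranslate y (freeResolvent hα hz f) - freeResolvent hα hz f) :
      SpinorL2 n N) = 𝓕 (spinorTranslate y (freeResolvent hα hz f)) - 𝓕 (freeResolvent hα hz f) :=
    map_sub (Lp.fourierTransformₗᵢ (EuclideanSpace ℝ (Fin n)) (EuclideanSpace ℂ (Fin N))) _ _
  rw [← Lp.norm_fourier_eq, ← Lp.norm_fourier_eq f, hsub]
  refine Lp.norm_le_mul_norm_of_ae_le_mul ?_
  filter_upwards [Lp.coeFn_sub (𝓕 (spinorTranslate y (freeResolvent hα hz f)) : SpinorL2 n N)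
    (𝓕 (freeResolvent hα hz f)), fourier_spinorTranslate_ae y (freeResolvent hα hz f),
    fourier_freeResolvent_ae hα hz f] with ξ h1 h2 h3
  rw [h1, Pi.sub_apply, h2, h3]
  set w := Matrix.toEuclideanCLM (𝕜 := ℂ) (resolventSymbol α z ξ) ((𝓕 f : SpinorL2 n N) ξ)
  have h4 : ‖(Real.fourierChar (inner ℝ y ξ) : ℂ) - 1‖ ≤ ‖y‖ * (2 * Real.pi * ‖ξ‖) := by
    rw [Real.fourierChar_apply, mul_comm _ Complex.I]
    refine Real.norm_exp_I_mul_ofReal_sub_one_le.trans ?_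
    rw [Real.norm_eq_abs, abs_mul, abs_of_pos (by positivity : 0 < 2 * Real.pi)]
    have := abs_real_inner_le_norm y ξ
    calc _ ≤ 2 * Real.pi * (‖y‖ * ‖ξ‖) := by gcongr
      _ = _ := by ring
  have h5 : (Real.fourierChar (inner ℝ y ξ) : ℂ) • w - w =
      ((Real.fourierChar (inner ℝ y ξ) : ℂ) - 1) • w := by rw [sub_smul, one_smul]
  rw [h5, norm_smul]
  calc _ ≤ ‖y‖ * (2 * Real.pi * ‖ξ‖) * ‖w‖ := by gcongr
    _ = ‖y‖ * (2 * Real.pi * ‖ξ‖ * ‖w‖) := by ring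
    _ ≤ ‖y‖ * ((1 + ‖z‖ * |z.im|⁻¹) * ‖(𝓕 f : SpinorL2 n N) ξ‖) := by
      exact mul_le_mul_of_nonneg_left (hα.norm_mul_resolventSymbol_apply_le hz ξ _) (norm_nonneg _)
    _ = _ := by ring

end FreeDirac

/-! ### Conjugation of the free operator by polynomial weights -/

section Weights

variable {n N : ℕ} {α : Fin (n + 1) → Matrix (Fin N) (Fin N) ℂ}

theorem toTempered_smulCLM {φ : EuclideanSpace ℝ (Fin n) → ℂ} (hφ : φ.HasTemperateGrowth)
    (hφ' : MemLp φ ∞ volume) (f : SpinorL2 n N) :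
    ((smulCLM hφ' f : SpinorL2 n N) : 𝓢'(EuclideanSpace ℝ (Fin n), EuclideanSpace ℂ (Fin N))) =
      TemperedDistribution.smulLeftCLM (EuclideanSpace ℂ (Fin N)) φ f :=
  ((smulLeftCLM_toTempered_eq_iff hφ f _).mpr (smulCLM_ae hφ' f)).symm

/-- The product rule for weak derivatives. -/
theorem HasWeakPartial.smulCLM {j : Fin n} {φ φ' : EuclideanSpace ℝ (Fin n) → ℂ}
    (hφ : φ.HasTemperateGrowth) (hφ' : φ'.HasTemperateGrowth) (hφb : MemLp φ ∞ volume)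
    (hφ'b : MemLp φ' ∞ volume)
    (hd : ∀ x, lineDeriv ℝ φ x (EuclideanSpace.single j (1 : ℝ)) = φ' x)
    {f g : SpinorL2 n N} (h : HasWeakPartial j f g) :
    HasWeakPartial j (_root_.smulCLM hφb f) (_root_.smulCLM hφb g + _root_.smulCLM hφ'b f) := by
  unfold HasWeakPartial at *
  rw [spinor_toTempered_add, toTempered_smulCLM hφ, toTempered_smulCLM hφ,
    toTempered_smulCLM hφ', ← h]
  -- By duality the claim becomes φ·(-∂ψ) = -∂(φψ) + φ'ψ for Schwartz functions ψ.
  ext ψ : 1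
  rw [add_apply]
  simp only [TemperedDistribution.lineDerivOp_apply_apply,
    TemperedDistribution.smulLeftCLM_apply_apply]
  rw [← map_add]
  congr 1
  ext x
  have h1 : DifferentiableAt ℝ φ x := (hφ.1.differentiable (by simp)) x
  have h2 : DifferentiableAt ℝ ψ x := ψ.differentiableAt
  have hd' := hd x
  rw [h1.lineDeriv_eq_fderiv] at hd'
  simp only [map_neg, neg_apply, add_apply,
    SchwartzMap.smulLeftCLM_apply_apply hφ, SchwartzMap.smulLeftCLM_apply_apply hφ',
    SchwartzMap.lineDerivOp_apply_eq_fderiv, SchwartzMap.smulLeftCLM_apply hφ]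
  rw [fderiv_fun_smul h1 h2]
  simp [hd']

/-- The weight `(1 + ‖ε x‖²) ^ r`. -/
noncomputable def weight (ε r : ℝ) (x : EuclideanSpace ℝ (Fin n)) : ℂ :=
  (((1 + ‖ε • x‖ ^ 2) ^ r : ℝ) : ℂ)

/-- The logarithmic derivative `∂ⱼ` of the weight. -/
noncomputable def weightLogDeriv (ε r : ℝ) (j : Fin n) (x : EuclideanSpace ℝ (Fin n)) : ℝ :=
  2 * r * ε ^ 2 * x j / (1 + ‖ε • x‖ ^ 2)

theorem hasTemperateGrowth_weight (ε r : ℝ) :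
    (weight ε r : EuclideanSpace ℝ (Fin n) → ℂ).HasTemperateGrowth := by
  have h1 : (fun x : EuclideanSpace ℝ (Fin n) => (1 + ‖x‖ ^ 2) ^ r).HasTemperateGrowth := by
    fun_prop
  have h2 : (fun x : EuclideanSpace ℝ (Fin n) => ε • x).HasTemperateGrowth :=
    (ε • ContinuousLinearMap.id ℝ (EuclideanSpace ℝ (Fin n))).hasTemperateGrowth
  exact Complex.ofRealCLM.hasTemperateGrowth.comp (h1.comp h2)

theorem norm_weight (ε r : ℝ) (x : EuclideanSpace ℝ (Fin n)) :
    ‖weight ε r x‖ = (1 + ‖ε • x‖ ^ 2) ^ r := by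
  rw [weight, Complex.norm_real, Real.norm_of_nonneg (by positivity)]

theorem norm_weight_le_one (ε : ℝ) {r : ℝ} (hr : r ≤ 0) (x : EuclideanSpace ℝ (Fin n)) :
    ‖weight ε r x‖ ≤ 1 := by
  rw [norm_weight]
  exact Real.rpow_le_one_of_one_le_of_nonpos (by nlinarith [sq_nonneg ‖ε • x‖]) hr

theorem memLp_weight (ε : ℝ) {r : ℝ} (hr : r ≤ 0) :
    MemLp (weight ε r : EuclideanSpace ℝ (Fin n) → ℂ) ∞ volume :=
  memLp_top_of_bound (hasTemperateGrowth_weight ε r).1.continuous.aestronglyMeasurable 1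
    (Filter.Eventually.of_forall (norm_weight_le_one ε hr))

theorem weight_mul_weight (ε r s : ℝ) (x : EuclideanSpace ℝ (Fin n)) :
    weight ε r x * weight ε s x = weight ε (r + s) x := by
  rw [weight, weight, weight, ← Complex.ofReal_mul, ← Real.rpow_add (by positivity)]

/-- Rewrites the derivative without a quotient, so its temperate growth is inherited from a
coordinate and a weight. -/
theorem weight_mul_logDeriv_eq (ε r : ℝ) (j : Fin n) (x : EuclideanSpace ℝ (Fin n)) :
    weight ε r x * weightLogDeriv ε r j x = (2 * r * ε ^ 2 : ℝ) * ((x j : ℝ) : ℂ) * weight ε (r - 1) x := by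
  rw [weight, weight, weightLogDeriv, Real.rpow_sub_one (by positivity)]
  push_cast
  ring

theorem lineDeriv_weight (ε r : ℝ) (j : Fin n) (x : EuclideanSpace ℝ (Fin n)) :
    lineDeriv ℝ (weight ε r) x (EuclideanSpace.single j (1 : ℝ)) =
      weight ε r x * weightLogDeriv ε r j x := by
  have h1 : HasFDerivAt (fun x : EuclideanSpace ℝ (Fin n) => 1 + ‖ε • x‖ ^ 2)
      (ε ^ 2 • (2 • innerSL ℝ x)) x := by
    have := ((hasStrictFDerivAt_norm_sq x).hasFDerivAt.const_mul (ε ^ 2)).const_add 1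
    refine this.congr_of_eventuallyEq (Filter.Eventually.of_forall fun y => ?_)
    simp [norm_smul, mul_pow]
  have h2 := h1.rpow_const (p := r) (Or.inl (by positivity))
  have h3 : HasFDerivAt (weight ε r) _ x := Complex.ofRealCLM.hasFDerivAt.comp x h2
  rw [h3.differentiableAt.lineDeriv_eq_fderiv, h3.fderiv, weight_mul_logDeriv_eq]
  simp [weight, EuclideanSpace.inner_single_right]
  ring

/-- With t = ε‖x‖ the gradient has size |r|ε · 2t/(1 + t²), and 2t ≤ 1 + t². The factor ε is what
makes the conjugation potential small. -/
theorem norm_weightLogDeriv_sq_le {ε : ℝ} (hε : 0 ≤ ε) (r : ℝ) (x : EuclideanSpace ℝ (Fin n)) :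
    ∑ j, weightLogDeriv ε r j x ^ 2 ≤ (|r| * ε) ^ 2 := by
  have h1 : ∑ j, weightLogDeriv ε r j x ^ 2 =
      (2 * r * ε ^ 2 * ‖x‖ / (1 + ‖ε • x‖ ^ 2)) ^ 2 := by
    have : ‖x‖ ^ 2 = ∑ j, x j ^ 2 := by simp [EuclideanSpace.norm_sq_eq]
    rw [div_pow, mul_pow, this, Finset.mul_sum, Finset.sum_div]
    refine Finset.sum_congr rfl fun j _ => ?_
    rw [weightLogDeriv, div_pow, mul_pow]
  rw [h1, ← sq_abs]
  gcongr
  rw [norm_smul, Real.norm_of_nonneg hε, abs_div, abs_of_pos (by positivity : 0 < 1 + (ε * ‖x‖) ^ 2),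
    div_le_iff₀ (by positivity), abs_mul, abs_mul, abs_mul, abs_of_nonneg (sq_nonneg ε),
    abs_of_nonneg (norm_nonneg x), abs_two]
  have : 0 ≤ |r| * ε * (1 - ε * ‖x‖) ^ 2 := by positivity
  nlinarith

theorem abs_weightLogDeriv_le {ε : ℝ} (hε : 0 ≤ ε) (r : ℝ) (j : Fin n)
    (x : EuclideanSpace ℝ (Fin n)) : |weightLogDeriv ε r j x| ≤ |r| * ε := by
  refine abs_le_of_sq_le_sq ?_ (by positivity)
  refine le_trans ?_ (norm_weightLogDeriv_sq_le hε r x)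
  exact Finset.single_le_sum (f := fun j => weightLogDeriv ε r j x ^ 2)
    (fun _ _ => sq_nonneg _) (Finset.mem_univ j)

theorem hasTemperateGrowth_weight_mul_logDeriv (ε r : ℝ) (j : Fin n) :
    (fun x : EuclideanSpace ℝ (Fin n) =>
      weight ε r x * (weightLogDeriv ε r j x : ℂ)).HasTemperateGrowth := by
  have h0 := hasTemperateGrowth_weight (n := n) ε (r - 1)
  have h1 : Function.HasTemperateGrowth fun x : EuclideanSpace ℝ (Fin n) =>
      ((inner ℝ x (EuclideanSpace.single j (1 : ℝ)) : ℝ) : ℂ) := by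
    fun_prop
  have h2 := ((Function.HasTemperateGrowth.const (E := EuclideanSpace ℝ (Fin n))
    ((2 * r * ε ^ 2 : ℝ) : ℂ)).mul h1).mul h0
  refine (congrArg Function.HasTemperateGrowth (funext fun x => ?_)).mp h2
  rw [weight_mul_logDeriv_eq]
  simp [EuclideanSpace.inner_single_right]

theorem memLp_weight_mul_logDeriv {ε : ℝ} (hε : 0 ≤ ε) {r : ℝ} (hr : r ≤ 0) (j : Fin n) :
    MemLp (fun x : EuclideanSpace ℝ (Fin n) => weight ε r x * (weightLogDeriv ε r j x : ℂ)) ∞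
      volume := by
  refine memLp_top_of_bound
    (hasTemperateGrowth_weight_mul_logDeriv ε r j).1.continuous.aestronglyMeasurable (1 * (|r| * ε))
    (Filter.Eventually.of_forall fun x => ?_)
  rw [norm_mul, Complex.norm_real, Real.norm_eq_abs]
  exact mul_le_mul (norm_weight_le_one ε hr x) (abs_weightLogDeriv_le hε r j x) (abs_nonneg _)
    zero_le_one

/-- The potential `-i ∑ⱼ (∂ⱼ log w) αⱼ` produced by conjugating `H₀` with a weight `w`. -/
noncomputable def weightPotential (α : Fin (n + 1) → Matrix (Fin N) (Fin N) ℂ) (ε r : ℝ)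
    (x : EuclideanSpace ℝ (Fin n)) : Matrix (Fin N) (Fin N) ℂ :=
  (-Complex.I) • ∑ j : Fin n, ((weightLogDeriv ε r j x : ℝ) : ℂ) • α j.castSucc

theorem norm_weightPotential_apply_le (hα : IsDiracFamily α) {ε : ℝ} (hε : 0 ≤ ε) (r : ℝ)
    (x : EuclideanSpace ℝ (Fin n)) (v : EuclideanSpace ℂ (Fin N)) :
    ‖Matrix.toEuclideanCLM (𝕜 := ℂ) (weightPotential α ε r x) v‖ ≤ |r| * ε * ‖v‖ := by
  rw [weightPotential, map_smul, smul_apply, norm_smul, norm_neg, Complex.norm_I, one_mul]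
  refine le_of_sq_le_sq ?_ (by positivity)
  rw [hα.norm_sum_apply, mul_pow]
  gcongr
  exact norm_weightLogDeriv_sq_le hε r x

theorem memLp_weightPotential (hα : IsDiracFamily α) {ε : ℝ} (hε : 0 ≤ ε) (r : ℝ) (l m : Fin N) :
    MemLp (fun x : EuclideanSpace ℝ (Fin n) => weightPotential α ε r x l m) ∞ volume := by
  refine memLp_top_of_bound ?_ (|r| * ε) (Filter.Eventually.of_forall fun x =>
    norm_apply_le_norm_toEuclideanCLM _ (norm_weightPotential_apply_le hα hε r x) l m)
  have hj : ∀ j, Continuous fun x : EuclideanSpace ℝ (Fin n) => weightLogDeriv ε r j x := fun j =>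
    Continuous.div (by fun_prop) (by fun_prop) fun x => by positivity
  have h : Continuous fun x : EuclideanSpace ℝ (Fin n) => weightPotential α ε r x := by
    unfold weightPotential
    fun_prop
  exact Continuous.aestronglyMeasurable (by fun_prop)

/-- Conjugation of the free Dirac operator with a weight. -/
theorem freeDirac_weight (hα : IsDiracFamily α) {ε : ℝ} (hε : 0 ≤ ε) {r : ℝ} (hr : r ≤ 0)
    (f : SpinorL2 n N) (hf : f ∈ (freeDirac α).domain) :
    ∃ h : smulCLM (memLp_weight ε hr) f ∈ (freeDirac α).domain,
      freeDirac α ⟨smulCLM (memLp_weight ε hr) f, h⟩ = smulCLM (memLp_weight ε hr)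
        (freeDirac α ⟨f, hf⟩ + mulCLM _ (memLp_weightPotential hα hε r) f) := by
  have hf' : f ∈ sobolevW12 n N := hf
  have h1 : ∀ j, HasWeakPartial j (smulCLM (memLp_weight ε hr) f)
      (smulCLM (memLp_weight ε hr) (weakPartial j ⟨f, hf'⟩) +
        smulCLM (memLp_weight_mul_logDeriv hε hr j) f) := fun j =>
    (weakPartial_spec j ⟨f, hf'⟩).smulCLM (hasTemperateGrowth_weight ε r)
      (hasTemperateGrowth_weight_mul_logDeriv ε r j) _ _ (lineDeriv_weight ε r j)
  have hmem : smulCLM (memLp_weight ε hr) f ∈ (freeDirac α).domain := fun j => ⟨_, h1 j⟩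
  have hmem' : smulCLM (memLp_weight ε hr) f ∈ sobolevW12 n N := hmem
  refine ⟨hmem, ?_⟩
  have h2 : ∀ j, weakPartial j ⟨_, hmem'⟩ = smulCLM (memLp_weight ε hr) (weakPartial j ⟨f, hf'⟩) +
        smulCLM (memLp_weight_mul_logDeriv hε hr j) f := fun j =>
    (weakPartial_spec j ⟨_, hmem'⟩).unique (h1 j)
  rw [freeDirac_apply hmem' hmem, freeDirac_apply hf' hf]
  simp only [h2]
  have h3 : ∀ (j : Fin n) (u : SpinorL2 n N), ∀ᵐ x,
      ((Matrix.toEuclideanCLM (𝕜 := ℂ) (α j.castSucc)).compLpL 2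
      (volume : Measure (EuclideanSpace ℝ (Fin n))) ((-Complex.I) • u) : SpinorL2 n N) x =
      (-Complex.I) • Matrix.toEuclideanCLM (𝕜 := ℂ) (α j.castSucc) (u x) := fun j u => by
    filter_upwards [(Matrix.toEuclideanCLM (𝕜 := ℂ) (α j.castSucc)).coeFn_compLpL (p := 2)
      (μ := (volume : Measure (EuclideanSpace ℝ (Fin n)))) ((-Complex.I) • u),
      Lp.coeFn_smul (-Complex.I) u] with x h4 h5
    rw [h4, h5, Pi.smul_apply, map_smul]
  have h4 : ∀ j : Fin n, ∀ᵐ x, (smulCLM (memLp_weight ε hr) (weakPartial j ⟨f, hf'⟩) +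
      smulCLM (memLp_weight_mul_logDeriv hε hr j) f : SpinorL2 n N) x =
      weight ε r x • (weakPartial j ⟨f, hf'⟩ x + (weightLogDeriv ε r j x : ℂ) • f x) := fun j => by
    filter_upwards [Lp.coeFn_add (smulCLM (memLp_weight ε hr) (weakPartial j ⟨f, hf'⟩))
      (smulCLM (memLp_weight_mul_logDeriv hε hr j) f), smulCLM_ae (memLp_weight ε hr)
      (weakPartial j ⟨f, hf'⟩), smulCLM_ae (memLp_weight_mul_logDeriv hε hr j) f] with x h5 h6 h7
    rw [h5, Pi.add_apply, h6, h7, smul_add, smul_smul]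
  refine Lp.ext ?_
  have h5 := fun j => h3 j (smulCLM (memLp_weight ε hr) (weakPartial j ⟨f, hf'⟩) +
        smulCLM (memLp_weight_mul_logDeriv hε hr j) f)
  have h6 := fun j => h3 j (weakPartial j ⟨f, hf'⟩)
  filter_upwards [coeFn_finset_sum Finset.univ fun j : Fin n =>
      (Matrix.toEuclideanCLM (𝕜 := ℂ) (α j.castSucc)).compLpL 2
      (volume : Measure (EuclideanSpace ℝ (Fin n))) ((-Complex.I) •
      (smulCLM (memLp_weight ε hr) (weakPartial j ⟨f, hf'⟩) +
        smulCLM (memLp_weight_mul_logDeriv hε hr j) f)),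
    coeFn_finset_sum Finset.univ fun j : Fin n =>
      (Matrix.toEuclideanCLM (𝕜 := ℂ) (α j.castSucc)).compLpL 2
      (volume : Measure (EuclideanSpace ℝ (Fin n))) ((-Complex.I) • weakPartial j ⟨f, hf'⟩),
    ae_all_iff.mpr h5, ae_all_iff.mpr h6, ae_all_iff.mpr h4,
    smulCLM_ae (memLp_weight ε hr) ((∑ j : Fin n,
      (Matrix.toEuclideanCLM (𝕜 := ℂ) (α j.castSucc)).compLpL 2
      (volume : Measure (EuclideanSpace ℝ (Fin n))) ((-Complex.I) • weakPartial j ⟨f, hf'⟩)) +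
      mulCLM _ (memLp_weightPotential hα hε r) f),
    Lp.coeFn_add (∑ j : Fin n,
      (Matrix.toEuclideanCLM (𝕜 := ℂ) (α j.castSucc)).compLpL 2
      (volume : Measure (EuclideanSpace ℝ (Fin n))) ((-Complex.I) • weakPartial j ⟨f, hf'⟩))
      (mulCLM _ (memLp_weightPotential hα hε r) f),
    mulCLM_ae (memLp_weightPotential hα hε r) f] with x k1 k2 k3 k4 k5 k6 k7 k8
  rw [k1, k6, k7, Pi.add_apply, k2, k8, weightPotential, map_smul, smul_apply, map_sum, sum_apply,
    Finset.smul_sum, ← Finset.sum_add_distrib, Finset.smul_sum]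
  refine Finset.sum_congr rfl fun j _ => ?_
  rw [k3, k4, k5]
  simp only [map_smul, map_add, smul_apply, smul_add, smul_smul]
  congr 2 <;> ring

end Weights

/-! ### Approximation by step functions on cubes -/

section Cells

variable {n N : ℕ}

theorem spinor_enorm_sq (f : SpinorL2 n N) : ‖f‖ₑ ^ 2 = ∫⁻ x, ‖f x‖ₑ ^ 2 := by
  rw [Lp.enorm_def, eLpNorm_eq_lintegral_rpow_enorm_toReal (by norm_num) (by norm_num),
    ← ENNReal.rpow_natCast, ← ENNReal.rpow_mul]
  simp

theorem volume_box (a b : Fin n → ℝ) :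
    volume {x : EuclideanSpace ℝ (Fin n) | ∀ i, x i ∈ Set.Ico (a i) (b i)} =
      ∏ i, ENNReal.ofReal (b i - a i) := by
  rw [← Real.volume_pi_Ico, ← (PiLp.volume_preserving_ofLp (Fin n)).measure_preimage
    (MeasurableSet.univ_pi fun i => measurableSet_Ico).nullMeasurableSet]
  congr 1
  ext x
  simp

theorem measurableSet_box (a b : Fin n → ℝ) :
    MeasurableSet {x : EuclideanSpace ℝ (Fin n) | ∀ i, x i ∈ Set.Ico (a i) (b i)} := by
  rw [Set.ofPred_forall]
  exact MeasurableSet.iInter fun i => (by fun_prop : Measurable fun x : EuclideanSpace ℝ (Fin n) =>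
    x i) measurableSet_Ico

/-- The multi-index of the cell of side `s` containing `x`. -/
noncomputable def cellIndex (s : ℝ) (x : EuclideanSpace ℝ (Fin n)) (i : Fin n) : ℤ := ⌊x i / s⌋

/-- The lower corner of the cell with multi-index `q`. -/
noncomputable def cellCorner (s : ℝ) (q : Fin n → ℤ) : EuclideanSpace ℝ (Fin n) :=
  WithLp.toLp 2 fun i => s * q i

theorem measurable_cellIndex (s : ℝ) :
    Measurable (cellIndex s : EuclideanSpace ℝ (Fin n) → Fin n → ℤ) := by
  refine measurable_pi_lambda _ fun i => Int.measurable_floor.comp ?_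
  fun_prop

theorem measurable_cellCorner_cellIndex (s : ℝ) :
    Measurable fun x : EuclideanSpace ℝ (Fin n) => cellCorner s (cellIndex s x) :=
  (measurable_of_countable (cellCorner s)).comp (measurable_cellIndex s)

theorem sub_cellCorner_mem {s : ℝ} (hs : 0 < s) (x : EuclideanSpace ℝ (Fin n)) (i : Fin n) :
    (x - cellCorner s (cellIndex s x)) i ∈ Set.Ico 0 s := by
  have h1 := Int.floor_le (x i / s)
  have h2 := Int.lt_floor_add_one (x i / s)
  rw [le_div_iff₀ hs] at h1
  rw [div_lt_iff₀ hs] at h2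
  simp only [cellCorner, cellIndex, PiLp.sub_apply, Set.mem_Ico]
  constructor <;> linarith

theorem volume_cell_ne_top {s : ℝ} (hs : 0 < s) (q : Fin n → ℤ) :
    volume (cellIndex s ⁻¹' {q} : Set (EuclideanSpace ℝ (Fin n))) ≠ ∞ := by
  refine ne_top_of_le_ne_top (b := volume {x : EuclideanSpace ℝ (Fin n) | ∀ i,
    x i ∈ Set.Ico (s * q i) (s * q i + s)}) ?_ (measure_mono ?_)
  · rw [volume_box]
    exact ENNReal.prod_ne_top fun i _ => ENNReal.ofReal_ne_top
  · rintro x rfl i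
    have := sub_cellCorner_mem hs x i
    simp only [cellCorner, PiLp.sub_apply, Set.mem_Ico] at this ⊢
    constructor <;> linarith

/-- The function equal to `c` on the cell `q`, as a linear function of `c`. -/
noncomputable def cellConst {s : ℝ} (hs : 0 < s) (q : Fin n → ℤ) :
    EuclideanSpace ℂ (Fin N) →ₗ[ℂ] SpinorL2 n N where
  toFun c := indicatorConstLp 2 (measurable_cellIndex s (measurableSet_singleton q))
    (volume_cell_ne_top hs q) c
  map_add' c d := by
    refine Lp.ext ?_
    filter_upwards [indicatorConstLp_coeFn (p := 2) (c := c + d)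
      (hs := measurable_cellIndex s (measurableSet_singleton q)) (hμs := volume_cell_ne_top hs q),
      indicatorConstLp_coeFn (p := 2) (c := c)
      (hs := measurable_cellIndex s (measurableSet_singleton q)) (hμs := volume_cell_ne_top hs q),
      indicatorConstLp_coeFn (p := 2) (c := d)
      (hs := measurable_cellIndex s (measurableSet_singleton q)) (hμs := volume_cell_ne_top hs q),
      Lp.coeFn_add (indicatorConstLp 2 (measurable_cellIndex s (measurableSet_singleton q))
        (volume_cell_ne_top hs q) c) (indicatorConstLp 2 (measurable_cellIndex s
        (measurableSet_singleton q)) (volume_cell_ne_top hs q) d)] with x h1 h2 h3 h4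
    rw [h1, h4, Pi.add_apply, h2, h3]
    by_cases hx : x ∈ cellIndex s ⁻¹' {q}
    · simp only [Set.indicator_of_mem hx]
    · simp only [Set.indicator_of_notMem hx, add_zero]
  map_smul' a c := by
    refine Lp.ext ?_
    filter_upwards [indicatorConstLp_coeFn (p := 2) (c := a • c)
      (hs := measurable_cellIndex s (measurableSet_singleton q)) (hμs := volume_cell_ne_top hs q),
      indicatorConstLp_coeFn (p := 2) (c := c)
      (hs := measurable_cellIndex s (measurableSet_singleton q)) (hμs := volume_cell_ne_top hs q),
      Lp.coeFn_smul a (indicatorConstLp 2 (measurable_cellIndex s (measurableSet_singleton q))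
        (volume_cell_ne_top hs q) c)] with x h1 h2 h3
    rw [RingHom.id_apply, h1, h3, Pi.smul_apply, h2]
    by_cases hx : x ∈ cellIndex s ⁻¹' {q}
    · simp only [Set.indicator_of_mem hx]
    · simp only [Set.indicator_of_notMem hx, smul_zero]

theorem cellConst_ae {s : ℝ} (hs : 0 < s) (q : Fin n → ℤ) (c : EuclideanSpace ℂ (Fin N)) :
    cellConst hs q c =ᵐ[volume] (cellIndex s ⁻¹' {q}).indicator fun _ => c :=
  indicatorConstLp_coeFn (hs := measurable_cellIndex s (measurableSet_singleton q))
    (hμs := volume_cell_ne_top hs q)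

/-- Functions that are constant on the cells indexed by `P` and vanish elsewhere. -/
noncomputable def cellStep {s : ℝ} (hs : 0 < s) (P : Finset (Fin n → ℤ)) :
    (P → EuclideanSpace ℂ (Fin N)) →ₗ[ℂ] SpinorL2 n N :=
  ∑ q : P, cellConst hs (q : Fin n → ℤ) ∘ₗ LinearMap.proj q

theorem cellStep_ae {s : ℝ} (hs : 0 < s) (P : Finset (Fin n → ℤ))
    (c : (Fin n → ℤ) → EuclideanSpace ℂ (Fin N)) :
    cellStep hs P (fun q => c q) =ᵐ[volume]
      (cellIndex s ⁻¹' P).indicator fun x => c (cellIndex s x) := by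
  have h : cellStep hs P (fun q => c q) = ∑ q ∈ P, cellConst hs q (c q) := by
    rw [cellStep, LinearMap.sum_apply, ← Finset.sum_coe_sort P]
    rfl
  rw [h]
  have h1 : ∀ᵐ x : EuclideanSpace ℝ (Fin n), ∀ q, cellConst (N := N) hs q (c q) x =
    (cellIndex s ⁻¹' {q}).indicator (fun _ => c q) x := ae_all_iff.mpr fun q => cellConst_ae hs q _
  filter_upwards [coeFn_finset_sum P fun q => cellConst (N := N) hs q (c q), h1] with x h2 h3
  rw [h2]
  simp only [h3]
  by_cases hx : cellIndex s x ∈ P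
  · rw [Set.indicator_of_mem (by exact hx), Finset.sum_eq_single (cellIndex s x)]
    · rw [Set.indicator_of_mem (by rfl)]
    · intro q _ hq
      exact Set.indicator_of_notMem (fun h => hq h.symm) _
    · exact fun h => absurd hx h
  · rw [Set.indicator_of_notMem (by exact hx)]
    refine Finset.sum_eq_zero fun q hq => Set.indicator_of_notMem (fun h => hx ?_) _
    have h' : cellIndex s x = q := h
    rwa [h']

theorem finrank_cellStep_range_le {s : ℝ} (hs : 0 < s) (P : Finset (Fin n → ℤ)) :
    Module.finrank ℂ (cellStep (N := N) hs P).range ≤ P.card * N := by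
  refine (LinearMap.finrank_range_le _).trans (le_of_eq ?_)
  rw [Module.finrank_pi_fintype]
  simp

/-- For v in [0, s)ⁿ the sample point differs from x by a vector of [-s, s)ⁿ, so the dependence on
the cell of x can be traded for a larger box of displacements. -/
theorem lintegral_cell_le {s : ℝ} (hs : 0 < s) (x : EuclideanSpace ℝ (Fin n))
    (h : EuclideanSpace ℝ (Fin n) → ℝ≥0∞) :
    ∫⁻ v in {v : EuclideanSpace ℝ (Fin n) | ∀ i, v i ∈ Set.Ico 0 s},
      h (cellCorner s (cellIndex s x) + v) ≤
    ∫⁻ t in {t : EuclideanSpace ℝ (Fin n) | ∀ i, t i ∈ Set.Ico (-s) s}, h (x + t) := by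
  rw [← lintegral_indicator (measurableSet_box _ _), ← lintegral_indicator (measurableSet_box _ _),
    ← lintegral_add_right_eq_self _ (x - cellCorner s (cellIndex s x))]
  refine lintegral_mono fun t => ?_
  by_cases ht : t + (x - cellCorner s (cellIndex s x)) ∈
      {v : EuclideanSpace ℝ (Fin n) | ∀ i, v i ∈ Set.Ico 0 s}
  · rw [Set.indicator_of_mem ht, Set.indicator_of_mem]
    · refine le_of_eq (congrArg h ?_)
      abel
    · intro i
      have h1 := ht i
      have h2 := sub_cellCorner_mem hs x i
      rw [PiLp.add_apply] at h1
      simp only [Set.mem_Ico] at h1 h2 ⊢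
      constructor <;> linarith
  · rw [Set.indicator_of_notMem ht]
    exact zero_le

/-- Sampling estimate: a function with Lipschitz translates in `L²` is close, on average, to one
of its samplings on the cells of side `s`. -/
theorem exists_sampling_le {s D : ℝ} (hs : 0 < s) (hD : 0 ≤ D) (u : SpinorL2 n N)
    (hu : ∀ y, ‖spinorTranslate y u - u‖ ≤ D * ‖y‖) :
    ∃ v, ∫⁻ x, ‖u x - u (cellCorner s (cellIndex s x) + v)‖ₑ ^ 2 ≤
      2 ^ n * ENNReal.ofReal (D * (n * s)) ^ 2 := by
  set Q := {v : EuclideanSpace ℝ (Fin n) | ∀ i, v i ∈ Set.Ico 0 s} with hQ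
  set T := {t : EuclideanSpace ℝ (Fin n) | ∀ i, t i ∈ Set.Ico (-s) s} with hT
  -- `u` is used through its chosen measurable representative, so sampling at points makes sense.
  have hum : Measurable u := (Lp.stronglyMeasurable u).measurable
  have hc := measurable_cellCorner_cellIndex (n := n) s
  have hQv : volume Q = ENNReal.ofReal s ^ n := by
    rw [hQ, volume_box]; simp
  have hTv : volume T = 2 ^ n * ENNReal.ofReal s ^ n := by
    rw [hT, volume_box, ← mul_pow]
    have h2 : ENNReal.ofReal (s - -s) = 2 * ENNReal.ofReal s := by
      rw [sub_neg_eq_add, ← two_mul, ENNReal.ofReal_mul (by norm_num)]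
      simp
    simp only [h2, Finset.prod_const, Finset.card_univ, Fintype.card_fin]
  have hQ0 : volume Q ≠ 0 := by
    rw [hQv]
    exact pow_ne_zero _ (by simpa using hs)
  have hQt : volume Q ≠ ∞ := by
    rw [hQv]
    exact ENNReal.pow_ne_top ENNReal.ofReal_ne_top
  have hmeas : Measurable (Function.uncurry fun v x : EuclideanSpace ℝ (Fin n) =>
      ‖u x - u (cellCorner s (cellIndex s x) + v)‖ₑ ^ 2) := by
    refine Measurable.pow_const (Measurable.enorm (Measurable.sub (hum.comp measurable_snd) (hum.comp ?_))) _
    exact (hc.comp measurable_snd).add measurable_fst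
  have hmeas' : Measurable (Function.uncurry fun t x : EuclideanSpace ℝ (Fin n) =>
      ‖u x - u (x + t)‖ₑ ^ 2) := by
    refine Measurable.pow_const (Measurable.enorm (Measurable.sub (hum.comp measurable_snd) (hum.comp ?_))) _
    exact measurable_snd.add measurable_fst
  -- Some offset does no worse than the average over the cube `Q`. Enlarging to displacements in `T`
  -- costs |T|/|Q| = 2^n, and each displacement has norm at most n·s.
  obtain ⟨v, -, hv⟩ := exists_le_setLAverage hQ0 hQt
    (f := fun v => ∫⁻ x, ‖u x - u (cellCorner s (cellIndex s x) + v)‖ₑ ^ 2)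
    (Measurable.lintegral_prod_right' hmeas).aemeasurable
  refine ⟨v, hv.trans ?_⟩
  rw [setLAverage_eq]
  refine ENNReal.div_le_of_le_mul ?_
  rw [lintegral_lintegral_swap hmeas.aemeasurable]
  refine (lintegral_mono fun x => lintegral_cell_le hs x fun y => ‖u x - u y‖ₑ ^ 2).trans ?_
  rw [← lintegral_lintegral_swap hmeas'.aemeasurable]
  have hint : ∀ t ∈ T, ∫⁻ x, ‖u x - u (x + t)‖ₑ ^ 2 ≤ ENNReal.ofReal (D * (n * s)) ^ 2 := by
    intro t ht
    have h1 : ∫⁻ x, ‖u x - u (x + t)‖ₑ ^ 2 = ‖spinorTranslate t u - u‖ₑ ^ 2 := by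
      rw [spinor_enorm_sq]
      refine lintegral_congr_ae ?_
      filter_upwards [Lp.coeFn_sub (spinorTranslate t u) u, spinorTranslate_ae t u] with x h2 h3
      rw [h2, Pi.sub_apply, h3, ← enorm_neg, neg_sub]
    rw [h1]
    gcongr
    rw [← ofReal_norm]
    refine ENNReal.ofReal_le_ofReal ((hu t).trans ?_)
    have ht' : ‖t‖ ≤ n * s := by
      have h4 : ∀ i, |t i| ≤ s := fun i => abs_le.mpr ⟨(ht i).1, (ht i).2.le⟩
      refine le_of_sq_le_sq ?_ (by positivity)
      rw [EuclideanSpace.norm_sq_eq]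
      have h5 : ∑ i, ‖t i‖ ^ 2 ≤ ∑ _i : Fin n, s ^ 2 := Finset.sum_le_sum fun i _ => by
        rw [Real.norm_eq_abs]
        gcongr
        exact h4 i
      refine h5.trans ?_
      rw [Finset.sum_const, Finset.card_univ, Fintype.card_fin, nsmul_eq_mul, mul_pow]
      gcongr
      have : (n : ℝ) ≤ (n ^ 2 : ℕ) := by exact_mod_cast Nat.le_self_pow two_ne_zero n
      simpa using this
    gcongr
  calc ∫⁻ t in T, ∫⁻ x, ‖u x - u (x + t)‖ₑ ^ 2
      ≤ ∫⁻ _t in T, ENNReal.ofReal (D * (n * s)) ^ 2 :=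
        setLIntegral_mono' (measurableSet_box _ _) hint
    _ = 2 ^ n * ENNReal.ofReal (D * (n * s)) ^ 2 * volume Q := by
        rw [setLIntegral_const, hTv, hQv]
        ring

/-- An operator with Lipschitz translates, cut off to finitely many cells, is close to finite
rank. -/
theorem ApproxBy.of_translate {s D : ℝ} (hs : 0 < s) (hD : 0 ≤ D)
    {R : SpinorL2 n N →L[ℂ] SpinorL2 n N}
    (hR : ∀ y f, ‖spinorTranslate y (R f) - R f‖ ≤ D * ‖y‖ * ‖f‖) (P : Finset (Fin n → ℤ))
    {φ : EuclideanSpace ℝ (Fin n) → ℂ} (hφ : MemLp φ ∞ volume) {M : ℝ} (hM : 0 ≤ M)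
    (hφM : ∀ x, ‖φ x‖ ≤ M) (hφP : ∀ x, cellIndex s x ∉ P → φ x = 0) :
    ApproxBy (smulCLM hφ * R) (P.card * N) (M * (2 ^ n * n * D * s)) := by
  -- This space does not depend on `f`; only the coefficients and the sampling offset do.
  set S := (cellStep (N := N) hs P).range.map
    ((smulCLM hφ : SpinorL2 n N →L[ℂ] SpinorL2 n N) : SpinorL2 n N →ₗ[ℂ] SpinorL2 n N)
  refine ApproxBy.of_subspace S ?_ (by positivity) fun f => ?_
  · exact_mod_cast (Submodule.finrank_map_le _ _).trans (finrank_cellStep_range_le hs P)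
  obtain ⟨v, hv⟩ := exists_sampling_le (D := D * ‖f‖) hs (by positivity) (R f) fun y => by
    refine (hR y f).trans (le_of_eq (by ring))
  refine ⟨_, ⟨_, ⟨fun q => R f (cellCorner s q + v), rfl⟩, rfl⟩, ?_⟩
  set g := cellStep hs P fun q : P => R f (cellCorner s q + v)
  have hg := cellStep_ae hs P fun q => R f (cellCorner s q + v)
  have h1 : ‖smulCLM hφ (R f) - smulCLM hφ g‖ₑ ^ 2 ≤
      ENNReal.ofReal (M * (2 ^ n * n * D * s) * ‖f‖) ^ 2 := by
    rw [spinor_enorm_sq]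
    calc ∫⁻ x, ‖(smulCLM hφ (R f) - smulCLM hφ g : SpinorL2 n N) x‖ₑ ^ 2
        ≤ ∫⁻ x, ENNReal.ofReal M ^ 2 * ‖R f x - R f (cellCorner s (cellIndex s x) + v)‖ₑ ^ 2 := by
          refine lintegral_mono_ae ?_
          filter_upwards [hg, Lp.coeFn_sub (smulCLM hφ (R f)) (smulCLM hφ g), smulCLM_ae hφ (R f),
            smulCLM_ae hφ g] with x k1 k2 k3 k4
          rw [k2, Pi.sub_apply, k3, k4, ← smul_sub, enorm_smul, mul_pow]
          by_cases hx : cellIndex s x ∈ P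
          · rw [k1, Set.indicator_of_mem (by exact hx)]
            gcongr
            rw [← ofReal_norm]
            exact ENNReal.ofReal_le_ofReal (hφM x)
          · rw [hφP x hx]
            simp
      _ ≤ ENNReal.ofReal M ^ 2 * (2 ^ n * ENNReal.ofReal (D * ‖f‖ * (n * s)) ^ 2) := by
          rw [lintegral_const_mul' _ _ (ENNReal.pow_ne_top ENNReal.ofReal_ne_top)]
          gcongr
      -- The constant is wastefully squared so that the right side becomes a perfect square.
      _ ≤ ENNReal.ofReal M ^ 2 * ((2 ^ n) ^ 2 * ENNReal.ofReal (D * ‖f‖ * (n * s)) ^ 2) := by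
          have h1 : (1 : ℝ≥0∞) ≤ 2 ^ n := one_le_pow₀ (by norm_num)
          exact mul_le_mul' le_rfl (mul_le_mul' (le_self_pow₀ h1 two_ne_zero) le_rfl)
      _ = _ := by
          have h2 : (2 : ℝ≥0∞) ^ n = ENNReal.ofReal (2 ^ n) := by
            rw [ENNReal.ofReal_pow (by norm_num)]; simp
          rw [h2, ← mul_pow, ← mul_pow, ← ENNReal.ofReal_mul (by positivity),
            ← ENNReal.ofReal_mul (by positivity)]
          congr 2
          ring
  have h2 : ‖smulCLM hφ (R f) - smulCLM hφ g‖ₑ ≤ ENNReal.ofReal (M * (2 ^ n * n * D * s) * ‖f‖) :=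
    (ENNReal.pow_le_pow_left_iff two_ne_zero).mp h1
  rw [← ofReal_norm, ENNReal.ofReal_le_ofReal_iff (by positivity)] at h2
  exact h2

end Cells

/-! ### Decaying weights: summation over dyadic shells -/

section Shells

variable {n N : ℕ}

theorem smulCLM_add_smulCLM {φ ψ θ : EuclideanSpace ℝ (Fin n) → ℂ} (hφ : MemLp φ ∞ volume)
    (hψ : MemLp ψ ∞ volume) (hθ : MemLp θ ∞ volume) (h : ∀ x, φ x + ψ x = θ x) :
    (smulCLM hφ : SpinorL2 n N →L[ℂ] SpinorL2 n N) + smulCLM hψ = smulCLM hθ := by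
  ext1 f
  rw [add_apply]
  refine Lp.ext ?_
  filter_upwards [smulCLM_ae hφ f, smulCLM_ae hψ f, smulCLM_ae hθ f,
    Lp.coeFn_add (smulCLM hφ f) (smulCLM hψ f)] with x h1 h2 h3 h4
  rw [h4, Pi.add_apply, h1, h2, h3, ← add_smul, h]

/-- The ball meets at most 2m cells per axis with m = ⌈L/s⌉, and `s ≤ L` gives 2m ≤ 4L/s. -/
theorem ApproxBy.of_translate_ball {s L D : ℝ} (hs : 0 < s) (hsL : s ≤ L) (hD : 0 ≤ D)
    {R : SpinorL2 n N →L[ℂ] SpinorL2 n N}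
    (hR : ∀ y f, ‖spinorTranslate y (R f) - R f‖ ≤ D * ‖y‖ * ‖f‖)
    {φ : EuclideanSpace ℝ (Fin n) → ℂ} (hφ : MemLp φ ∞ volume) {M : ℝ} (hM : 0 ≤ M)
    (hφM : ∀ x, ‖φ x‖ ≤ M) (hφL : ∀ x, L ≤ ‖x‖ → φ x = 0) :
    ApproxBy (smulCLM hφ * R) ((4 * (L / s)) ^ n * N) (M * (2 ^ n * n * D * s)) := by
  set m := ⌈L / s⌉₊ with hm
  have hLs : 1 ≤ L / s := (one_le_div hs).mpr hsL
  have hm1 : L / s ≤ m := Nat.le_ceil _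
  have hm2 : (m : ℝ) < L / s + 1 := Nat.ceil_lt_add_one (by linarith)
  refine (ApproxBy.of_translate hs hD hR (Fintype.piFinset fun _ : Fin n => Finset.Ico (-(m : ℤ)) m)
    hφ hM hφM fun x hx => hφL x ?_).mono ?_ le_rfl
  · by_contra hxL
    refine hx (Fintype.mem_piFinset.mpr fun i => ?_)
    have h1 : |x i| < s * m := by
      refine lt_of_le_of_lt (PiLp.norm_apply_le x i) ((not_le.mp hxL).trans_le ?_)
      rwa [div_le_iff₀ hs, mul_comm] at hm1
    rw [abs_lt] at h1
    rw [Finset.mem_Ico, cellIndex, Int.le_floor, Int.floor_lt]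
    push_cast
    rw [le_div_iff₀ hs, div_lt_iff₀ hs]
    constructor <;> linarith
  · rw [Fintype.card_piFinset]
    simp only [Int.card_Ico, Finset.prod_const, Finset.card_univ, Fintype.card_fin]
    have h2 : ((m : ℤ) - -(m : ℤ)).toNat = 2 * m := by lia
    rw [h2]
    push_cast
    have h3 : 2 * (m : ℝ) ≤ 4 * (L / s) := by linarith
    exact mul_le_mul_of_nonneg_right (pow_le_pow_left₀ (by positivity) h3 n) (Nat.cast_nonneg N)

theorem approxBy_shells {R : SpinorL2 n N →L[ℂ] SpinorL2 n N}
    {φ : EuclideanSpace ℝ (Fin n) → ℂ} (hφ : MemLp φ ∞ volume) {A : ℕ → Set (EuclideanSpace ℝ (Fin n))}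
    (hA : ∀ i, MeasurableSet (A i)) (hmono : Monotone A) {r e : ℕ → ℝ}
    (h0 : ApproxBy (smulCLM (hφ.indicator (hA 0)) * R) (r 0) (e 0))
    (hsucc : ∀ i, ApproxBy (smulCLM (hφ.indicator ((hA (i + 1)).diff (hA i))) * R) (r (i + 1))
      (e (i + 1))) (J : ℕ) :
    ApproxBy (smulCLM (hφ.indicator (hA J)) * R) (∑ i ∈ Finset.range (J + 1), r i)
      (∑ i ∈ Finset.range (J + 1), e i) := by
  induction J with
  | zero => simpa using h0
  | succ J ih =>
    rw [Finset.sum_range_succ, Finset.sum_range_succ _ (J + 1)]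
    have h1 : (smulCLM (hφ.indicator (hA (J + 1))) : SpinorL2 n N →L[ℂ] SpinorL2 n N) =
        smulCLM (hφ.indicator (hA J)) + smulCLM (hφ.indicator ((hA (J + 1)).diff (hA J))) := by
      refine (smulCLM_add_smulCLM _ _ _ fun x => ?_).symm
      have hm : A J ⊆ A (J + 1) := hmono (Nat.le_succ J)
      by_cases h2 : x ∈ A J
      · rw [Set.indicator_of_mem h2, Set.indicator_of_mem (hm h2),
          Set.indicator_of_notMem (fun h => h.2 h2), add_zero]
      · rw [Set.indicator_of_notMem h2, zero_add]
        by_cases h3 : x ∈ A (J + 1)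
        · rw [Set.indicator_of_mem h3, Set.indicator_of_mem (s := A (J + 1) \ A J) ⟨h3, h2⟩]
        · rw [Set.indicator_of_notMem h3, Set.indicator_of_notMem (fun h => h3 h.1)]
    rw [h1, add_mul]
    exact ih.add (hsucc J)

/-- Take I = ⌊log₂ t / κ⌋. The rank bound is then at most Ct, and rounding down loses at most the
factor 2^a in the error. -/
theorem ApproxOrder.of_dyadic {E : Type*} [NormedAddCommGroup E] [InnerProductSpace ℂ E]
    {T : E →L[ℂ] E} {C κ a γ : ℝ} (hκ : 0 < κ) (ha : 0 < a) (hγ : γ * κ ≤ a)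
    (h : ∀ I : ℕ, ApproxBy T (C * 2 ^ (I * κ)) (C * 2 ^ (-(I * a)))) : ApproxOrder γ T := by
  have hC : 0 ≤ C := by
    obtain ⟨F, -, -, h3⟩ := h 0
    simpa using (norm_nonneg _).trans h3
  refine ⟨C * 2 ^ a, fun t ht => ?_⟩
  have ht0 : 0 < t := by linarith
  set x := Real.logb 2 t with hx
  have hx0 : 0 ≤ x := Real.logb_nonneg one_lt_two ht
  have htx : t = 2 ^ x := (Real.rpow_logb two_pos (by norm_num) ht0).symm
  have h1 := Nat.floor_le (div_nonneg hx0 hκ.le)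
  have h2 := Nat.lt_floor_add_one (x / κ)
  rw [le_div_iff₀ hκ] at h1
  rw [div_lt_iff₀ hκ] at h2
  refine (h ⌊x / κ⌋₊).mono ?_ ?_
  · rw [mul_assoc]
    refine mul_le_mul_of_nonneg_left ?_ hC
    calc (2 : ℝ) ^ (⌊x / κ⌋₊ * κ) ≤ 2 ^ x := Real.rpow_le_rpow_of_exponent_le one_le_two h1
      _ = t := htx.symm
      _ ≤ 2 ^ a * t := le_mul_of_one_le_left ht0.le (Real.one_le_rpow one_le_two ha.le)
  · rw [mul_assoc]
    refine mul_le_mul_of_nonneg_left ?_ hC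
    rw [htx, ← Real.rpow_mul two_pos.le, ← Real.rpow_add two_pos]
    refine Real.rpow_le_rpow_of_exponent_le one_le_two ?_
    have h3 : x * γ ≤ (⌊x / κ⌋₊ + 1) * a := by
      rcases le_or_gt 0 γ with hg | hg
      · calc x * γ ≤ ((⌊x / κ⌋₊ + 1) * κ) * γ := mul_le_mul_of_nonneg_right h2.le hg
          _ = (⌊x / κ⌋₊ + 1) * (γ * κ) := by ring
          _ ≤ _ := by gcongr
      · exact (mul_nonpos_of_nonneg_of_nonpos hx0 hg.le).trans (by positivity)
    linarith

/-- Approximation numbers of `φ(x) R`, where `φ` decays like `‖x‖ ^ (-a)` and `R` has Lipschitz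
translates. -/
theorem approxOrder_of_decay (hn : 1 ≤ n) {D : ℝ} (hD : 0 ≤ D) {R : SpinorL2 n N →L[ℂ] SpinorL2 n N}
    (hR : ∀ y f, ‖spinorTranslate y (R f) - R f‖ ≤ D * ‖y‖ * ‖f‖)
    {φ : EuclideanSpace ℝ (Fin n) → ℂ} (hφ : MemLp φ ∞ volume) {a K : ℝ} (ha : 0 < a) (ha1 : a < 1)
    (hK : 0 ≤ K) (hφ1 : ∀ x, ‖φ x‖ ≤ K) (hφa : ∀ x, ‖φ x‖ * ‖x‖ ^ a ≤ K) {γ : ℝ}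
    (hγ : γ * n < a) : ApproxOrder γ (smulCLM hφ * R) := by
  -- On the shell of radius 2^i, i ≤ I, the mesh will be 2^(ib - Ia). Then b < a makes the errors
  -- sum to O(2^(-Ia)), while the ranks sum to O(2^(Iκ)) with κ = n(a + 1 - b). As b tends to a, a/κ
  -- tends to a/n, so b close enough to a reaches the given γ.
  obtain ⟨b, hb0, hba, hbγ⟩ : ∃ b : ℝ, 0 ≤ b ∧ b < a ∧ γ * (n * (a + 1 - b)) ≤ a := by
    rcases le_or_gt γ 0 with hg | hg
    · refine ⟨0, le_rfl, ha, ?_⟩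
      exact (mul_nonpos_of_nonpos_of_nonneg hg
        (mul_nonneg (Nat.cast_nonneg n) (by linarith))).trans ha.le
    · have hgn : 0 < γ * n := by positivity
      refine ⟨a - min a (a / (γ * n) - 1), ?_, ?_, ?_⟩
      · linarith [min_le_left a (a / (γ * n) - 1)]
      · have : 0 < a / (γ * n) - 1 := by
          rw [sub_pos, one_lt_div hgn]
          exact hγ
        linarith [lt_min ha this]
      · have h1 : a + 1 - (a - min a (a / (γ * n) - 1)) ≤ a / (γ * n) := by
          linarith [min_le_right a (a / (γ * n) - 1)]
        rw [le_div_iff₀ hgn] at h1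
        linarith
  set c : ℝ := 2 ^ n * n * D with hc
  have hc0 : 0 ≤ c := by positivity
  set A : ℕ → Set (EuclideanSpace ℝ (Fin n)) := fun i => Metric.ball 0 (2 ^ i) with hAdef
  have hA : ∀ i, MeasurableSet (A i) := fun i => measurableSet_ball
  have hAmono : Monotone A := fun i j hij =>
    Metric.ball_subset_ball (pow_le_pow_right₀ one_le_two hij)
  have hmemA : ∀ i x, x ∈ A i ↔ ‖x‖ < 2 ^ i := fun i x => by simp [hAdef]
  set q : ℝ := 2 ^ (n * (1 - b)) with hq
  set p : ℝ := 2 ^ (-(a - b)) with hp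
  have hn' : (1 : ℝ) ≤ n := by exact_mod_cast hn
  have hq1 : 1 < q := Real.one_lt_rpow one_lt_two (mul_pos (by linarith) (by linarith))
  have hp0 : 0 < p := by positivity
  have hp1 : p < 1 := Real.rpow_lt_one_of_one_lt_of_neg one_lt_two (by linarith)
  -- decay of `φ` off a ball
  have hdecay : ∀ (i : ℕ) x, 2 ^ i ≤ ‖x‖ → ‖φ x‖ ≤ K * 2 ^ (-(i * a)) := by
    intro i x hx
    have h1 : (2 : ℝ) ^ (i * a) ≤ ‖x‖ ^ a := by
      rw [Real.rpow_mul two_pos.le, Real.rpow_natCast]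
      exact Real.rpow_le_rpow (by positivity) hx ha.le
    rw [Real.rpow_neg two_pos.le, ← div_eq_mul_inv, le_div_iff₀ (by positivity)]
    exact (mul_le_mul_of_nonneg_left h1 (norm_nonneg _)).trans (hφa x)
  have main : ∀ I : ℕ, ApproxBy (smulCLM hφ * R)
      (∑ i ∈ Finset.range (I + 1), (4 * ((2 : ℝ) ^ i / 2 ^ (i * b - I * a))) ^ n * N + 0)
      (∑ i ∈ Finset.range (I + 1), 2 * K * 2 ^ (-(i * a)) * (c * 2 ^ (i * b - I * a)) +
        K * 2 ^ (-(I * a)) * ‖R‖) := by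
    intro I
    have hsi : ∀ i : ℕ, (2 : ℝ) ^ (i * b - I * a) ≤ 2 ^ i := fun i => by
      rw [← Real.rpow_natCast 2 i]
      refine Real.rpow_le_rpow_of_exponent_le one_le_two ?_
      have : (i : ℝ) * b ≤ i * 1 := by gcongr; linarith
      have : 0 ≤ (I : ℝ) * a := by positivity
      linarith
    have hbound : ∀ i : ℕ, 0 ≤ 2 * K * 2 ^ (-(i * a)) := fun i => by positivity
    have hsh := approxBy_shells (R := R) hφ hA hAmono
      (r := fun i => (4 * ((2 : ℝ) ^ i / 2 ^ (i * b - I * a))) ^ n * N)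
      (e := fun i => 2 * K * 2 ^ (-(i * a)) * (c * 2 ^ (i * b - I * a)))
      (by
        refine ApproxBy.of_translate_ball (by positivity) (hsi 0) hD hR _ (hbound 0) (fun x => ?_)
          fun x hx => Set.indicator_of_notMem (fun h => ?_) _
        · refine (norm_indicator_le_norm_self _ _).trans ((hφ1 x).trans ?_)
          simp
          linarith
        · exact absurd ((hmemA 0 x).mp h) (not_lt.mpr hx))
      (fun i => by
        refine ApproxBy.of_translate_ball (by positivity) (hsi (i + 1)) hD hR _ (hbound (i + 1))
          (fun x => ?_) fun x hx => Set.indicator_of_notMem (fun h => ?_) _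
        · by_cases hx : x ∈ A (i + 1) \ A i
          · rw [Set.indicator_of_mem hx]
            refine (hdecay i x (not_lt.mp fun h => hx.2 ((hmemA i x).mpr h))).trans ?_
            -- Decay is known at the inner radius 2^i; passing to index i + 1 costs 2^a ≤ 2, the
            -- source of the factor 2 in the bound.
            rw [mul_comm 2 K, mul_assoc K]
            refine mul_le_mul_of_nonneg_left ?_ hK
            nth_rw 2 [← Real.rpow_one 2]
            rw [← Real.rpow_add two_pos]
            refine Real.rpow_le_rpow_of_exponent_le one_le_two ?_
            push_cast
            linarith
          · rw [Set.indicator_of_notMem hx, norm_zero]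
            exact hbound _
        · exact absurd ((hmemA (i + 1) x).mp h.1) (not_lt.mpr hx)) I
    -- Outside the ball of radius 2^I nothing is approximated: the decay of `φ` alone gives the
    -- error 2^(-Ia).
    have hrem : ApproxBy (smulCLM (hφ.indicator (hA I).compl) * R) 0 (K * 2 ^ (-(I * a)) * ‖R‖) := by
      refine ApproxBy.of_norm_le ((norm_mul_le _ _).trans ?_)
      refine mul_le_mul_of_nonneg_right (norm_smulCLM_le _ (by positivity)
        (Filter.Eventually.of_forall fun x => ?_)) (norm_nonneg _)
      by_cases hx : x ∈ (A I)ᶜ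
      · rw [Set.indicator_of_mem hx]
        exact hdecay I x (not_lt.mp fun h => hx ((hmemA I x).mpr h))
      · rw [Set.indicator_of_notMem hx, norm_zero]
        positivity
    have hsum := hsh.add hrem
    rwa [← add_mul, smulCLM_add_smulCLM (hφ.indicator (hA I)) (hφ.indicator (hA I).compl) hφ
      (fun x => congrFun (Set.indicator_self_add_compl (A I) φ) x)] at hsum
  refine ApproxOrder.of_dyadic (C := max (4 ^ n * N * (q / (q - 1)))
    (2 * K * c * (1 - p)⁻¹ + K * ‖R‖)) (κ := n * (a + 1 - b)) (a := a)
    (mul_pos (by linarith) (by linarith)) ha hbγ fun I => (main I).mono ?_ ?_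
  · rw [add_zero]
    have h1 : ∀ i : ℕ, (4 * ((2 : ℝ) ^ i / 2 ^ (i * b - I * a))) ^ n * N =
        4 ^ n * N * 2 ^ (I * a * n) * q ^ i := fun i => by
      have h2 : (2 : ℝ) ^ i / 2 ^ (i * b - I * a) = 2 ^ (i * (1 - b) + I * a) := by
        rw [← Real.rpow_natCast 2 i, ← Real.rpow_sub two_pos]
        congr 1
        ring
      rw [h2, mul_pow, ← Real.rpow_natCast (2 ^ _) n, ← Real.rpow_mul two_pos.le, hq,
        ← Real.rpow_natCast (2 ^ _) i, ← Real.rpow_mul two_pos.le, mul_assoc _ (2 ^ _) (2 ^ _),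
        ← Real.rpow_add two_pos]
      ring_nf
    rw [Finset.sum_congr rfl fun i _ => h1 i, ← Finset.mul_sum, geom_sum_eq hq1.ne']
    have h3 : (q ^ (I + 1) - 1) / (q - 1) ≤ q / (q - 1) * q ^ I := by
      rw [div_mul_eq_mul_div, ← pow_succ']
      have : 0 < q - 1 := by linarith
      gcongr
      linarith
    calc _ ≤ 4 ^ n * N * 2 ^ (I * a * n) * (q / (q - 1) * q ^ I) := by gcongr
      _ = 4 ^ n * N * (q / (q - 1)) * (2 ^ (I * a * n) * q ^ I) := by ring
      _ = 4 ^ n * N * (q / (q - 1)) * 2 ^ (I * (n * (a + 1 - b))) := by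
        congr 1
        rw [hq, ← Real.rpow_natCast (2 ^ _) I, ← Real.rpow_mul two_pos.le, ← Real.rpow_add two_pos]
        congr 1
        ring
      _ ≤ _ := by
        gcongr
        exact le_max_left _ _
  · have h1 : ∀ i : ℕ, 2 * K * 2 ^ (-(i * a)) * (c * 2 ^ (i * b - I * a)) =
        2 * K * c * 2 ^ (-(I * a)) * p ^ i := fun i => by
      have h2 : (2 : ℝ) ^ (-(i * a)) * 2 ^ (i * b - I * a) = 2 ^ (-(I * a)) * p ^ i := by
        rw [hp, ← Real.rpow_natCast (2 ^ _) i, ← Real.rpow_mul two_pos.le, ← Real.rpow_add two_pos,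
          ← Real.rpow_add two_pos]
        congr 1
        ring
      linear_combination (2 * K * c) * h2
    rw [Finset.sum_congr rfl fun i _ => h1 i, ← Finset.mul_sum]
    have h3 : ∑ i ∈ Finset.range (I + 1), p ^ i ≤ (1 - p)⁻¹ := by
      rw [← tsum_geometric_of_lt_one hp0.le hp1]
      exact (summable_geometric_of_lt_one hp0.le hp1).sum_le_tsum _ fun _ _ => by positivity
    calc _ ≤ 2 * K * c * 2 ^ (-(I * a)) * (1 - p)⁻¹ + K * 2 ^ (-(I * a)) * ‖R‖ := by gcongr
      _ = (2 * K * c * (1 - p)⁻¹ + K * ‖R‖) * 2 ^ (-(I * a)) := by ring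
      _ ≤ _ := by
        gcongr
        exact le_max_right _ _

end Shells

/-! ### Distribution of the weights among the resolvents -/

section Main

variable {n N : ℕ} {α : Fin (n + 1) → Matrix (Fin N) (Fin N) ℂ}

/-- Multiplication by the `j`-th power of the weight `(1 + ‖ε x‖²) ^ r`. -/
noncomputable def weightOp (ε : ℝ) {r : ℝ} (hr : r ≤ 0) (j : ℕ) :
    SpinorL2 n N →L[ℂ] SpinorL2 n N :=
  smulCLM (memLp_weight ε (mul_nonpos_of_nonneg_of_nonpos (Nat.cast_nonneg j) hr))

theorem weightOp_add (ε : ℝ) {r : ℝ} (hr : r ≤ 0) (i j : ℕ) :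
    (weightOp ε hr (i + j) : SpinorL2 n N →L[ℂ] SpinorL2 n N) =
      weightOp ε hr i * weightOp ε hr j := by
  refine (smulCLM_mul_smulCLM _ _ _ (Filter.Eventually.of_forall fun x => ?_)).symm
  rw [weight_mul_weight]
  push_cast
  ring_nf

theorem weightOp_mulCLM_comm (ε : ℝ) {r : ℝ} (hr : r ≤ 0) (j : ℕ)
    {U : EuclideanSpace ℝ (Fin n) → Matrix (Fin N) (Fin N) ℂ}
    (hU : ∀ l m, MemLp (fun x => U x l m) ∞ volume) (f : SpinorL2 n N) :
    weightOp ε hr j (mulCLM U hU f) = mulCLM U hU (weightOp ε hr j f) :=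
  congrArg (fun A : SpinorL2 n N →L[ℂ] SpinorL2 n N => A f) (smulCLM_mulCLM_comm _ hU)

/-- The bounded operator `B` in `H₀ W = W (H₀ + B)`, with `W` the `j`-th power of the weight. -/
noncomputable def weightPotentialOp (hα : IsDiracFamily α) {ε : ℝ} (hε : 0 ≤ ε) (r : ℝ) (j : ℕ) :
    SpinorL2 n N →L[ℂ] SpinorL2 n N :=
  mulCLM _ (memLp_weightPotential hα hε (j * r))

theorem norm_weightPotentialOp_le (hα : IsDiracFamily α) {ε : ℝ} (hε : 0 ≤ ε) (r : ℝ) (j : ℕ) :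
    ‖weightPotentialOp hα hε r j‖ ≤ j * |r| * ε := by
  have h : |(j : ℝ) * r| = j * |r| := by rw [abs_mul, Nat.abs_cast]
  rw [← h]
  exact norm_mulCLM_le _ (by positivity)
    (Filter.Eventually.of_forall fun x => norm_weightPotential_apply_le hα hε _ x)

theorem freeDirac_weightOp (hα : IsDiracFamily α) {ε : ℝ} (hε : 0 ≤ ε) {r : ℝ} (hr : r ≤ 0) (j : ℕ)
    (f : SpinorL2 n N) (hf : f ∈ (freeDirac α).domain) :
    ∃ h : weightOp ε hr j f ∈ (freeDirac α).domain,
      freeDirac α ⟨weightOp ε hr j f, h⟩ =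
        weightOp ε hr j (freeDirac α ⟨f, hf⟩ + weightPotentialOp hα hε r j f) :=
  freeDirac_weight hα hε (mul_nonpos_of_nonneg_of_nonpos (Nat.cast_nonneg j) hr) f hf

/-- H W = W (H + B), since the scalar weight commutes with V; passing to inverses moves W to the
left of the resolvent. -/
theorem mul_weightOp_eq (hα : IsDiracFamily α) {ε : ℝ} (hε : 0 ≤ ε) {r : ℝ} (hr : r ≤ 0) (j : ℕ)
    {V : EuclideanSpace ℝ (Fin n) → Matrix (Fin N) (Fin N) ℂ}
    (hV : ∀ l m, MemLp (fun x => V x l m) ∞ volume) {z : ℂ}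
    {R R' : SpinorL2 n N →L[ℂ] SpinorL2 n N} (hR : IsResolvent (dirac α V hV) z R)
    (hR' : IsResolvent ((weightPotentialOp hα hε r j : SpinorL2 n N →ₗ[ℂ] SpinorL2 n N) +ᵥ
      dirac α V hV) z R') : R * weightOp ε hr j = weightOp ε hr j * R' := by
  refine hR.mul_eq_mul hR' fun f hf => ?_
  obtain ⟨h1, h2⟩ := freeDirac_weightOp hα hε hr j f hf
  refine ⟨h1, ?_⟩
  change mulCLM V hV (weightOp ε hr j f) + freeDirac α ⟨weightOp ε hr j f, h1⟩ =
    weightOp ε hr j (weightPotentialOp hα hε r j f + (mulCLM V hV f + freeDirac α ⟨f, hf⟩))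
  rw [h2, ← weightOp_mulCLM_comm, ← map_add]
  congr 1
  abel

/-- The mirror image: W H₀ = (H₀ - B) W, hence the opposite sign of the perturbation. -/
theorem weightOp_mul_eq (hα : IsDiracFamily α) {ε : ℝ} (hε : 0 ≤ ε) {r : ℝ} (hr : r ≤ 0) (j : ℕ)
    {z : ℂ} {R R' : SpinorL2 n N →L[ℂ] SpinorL2 n N} (hR : IsResolvent (freeDirac α) z R)
    (hR' : IsResolvent (((-weightPotentialOp hα hε r j : SpinorL2 n N →L[ℂ] SpinorL2 n N) :
      SpinorL2 n N →ₗ[ℂ] SpinorL2 n N) +ᵥ freeDirac α) z R') :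
    weightOp ε hr j * R = R' * weightOp ε hr j := by
  refine (hR'.mul_eq_mul hR fun f hf => ?_).symm
  obtain ⟨h1, h2⟩ := freeDirac_weightOp hα hε hr j f hf
  refine ⟨h1, ?_⟩
  change -weightPotentialOp hα hε r j (weightOp ε hr j f) + freeDirac α ⟨weightOp ε hr j f, h1⟩ =
    weightOp ε hr j (freeDirac α ⟨f, hf⟩)
  rw [h2, map_add, weightPotentialOp, weightOp_mulCLM_comm]
  abel

/-- The second resolvent identity leaves the free resolvent next to the weight, followed by a
bounded factor. Hence `D` may be any bounded operator, without decay. -/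
theorem approxOrder_weightOp_mul_resolvent (hn : 1 ≤ n) (hα : IsDiracFamily α) {ε : ℝ} (hε : 0 < ε)
    (hε1 : ε ≤ 1) {a : ℝ} (ha : 0 < a) (ha1 : a < 1) (hr : -(a / 2) ≤ 0) {γ : ℝ} (hγ : γ * n < a)
    {z : ℂ} (hz : z.im ≠ 0) {R D : SpinorL2 n N →L[ℂ] SpinorL2 n N}
    (hR : IsResolvent ((D : SpinorL2 n N →ₗ[ℂ] SpinorL2 n N) +ᵥ freeDirac α) z R) :
    ApproxOrder γ (weightOp ε hr 1 * R) := by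
  rw [(isResolvent_freeResolvent hα hz).sub_eq hR, ← mul_assoc]
  refine ApproxOrder.mul_bounded ?_ _
  refine approxOrder_of_decay hn (D := 1 + ‖z‖ * |z.im|⁻¹) (by positivity)
    (norm_translate_freeResolvent_sub_le hα hz) _ ha ha1 (K := (ε ^ a)⁻¹) (by positivity)
    (fun x => ?_) (fun x => ?_) hγ
  · refine (norm_weight_le_one ε (by simpa using hr) x).trans ?_
    exact (one_le_inv₀ (by positivity)).mpr (Real.rpow_le_one hε.le hε1 ha.le)
  · rw [norm_weight, Nat.cast_one, one_mul, norm_smul, Real.norm_of_nonneg hε.le,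
      Real.rpow_neg (by positivity)]
    have h1 : (ε * ‖x‖) ^ a ≤ (1 + (ε * ‖x‖) ^ 2) ^ (a / 2) := by
      have h2 : (ε * ‖x‖) ^ a = ((ε * ‖x‖) ^ 2) ^ (a / 2) := by
        rw [← Real.rpow_natCast, ← Real.rpow_mul (by positivity)]
        congr 1
        push_cast
        ring
      rw [h2]
      exact Real.rpow_le_rpow (by positivity) (by linarith) (by positivity)
    rw [Real.mul_rpow hε.le (norm_nonneg x)] at h1
    rw [inv_mul_eq_div, div_le_iff₀ (by positivity), inv_mul_eq_div, le_div_iff₀ (by positivity)]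
    linarith

/-- The innermost resolvent passes all m + 1 weights at once and keeps one of them: R^(m+1) W_(m+1)
= (R^m W_m)(W_1 S_(m+1)). -/
theorem approxOrder_resolvent_pow_mul {E : Type*} [NormedAddCommGroup E] [InnerProductSpace ℂ E]
    {R : E →L[ℂ] E} {W S : ℕ → E →L[ℂ] E} {γ : ℝ} {k : ℕ} (hW : ∀ i j, W (i + j) = W i * W j)
    (hRW : ∀ j ≤ k, R * W j = W j * S j) (hS : ∀ j ≤ k, ApproxOrder γ (W 1 * S j)) :
    ∀ m ≤ k, ApproxOrder (m * γ) (R ^ m * W m) := by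
  intro m
  induction m with
  | zero =>
    intro _
    simpa using ApproxOrder.of_bounded (W 0)
  | succ m ih =>
    intro hm
    have h1 : R ^ (m + 1) * W (m + 1) = R ^ m * W m * (W 1 * S (m + 1)) := by
      rw [pow_succ, mul_assoc, hRW _ hm, hW]
      simp only [mul_assoc]
    have h2 : ((m + 1 : ℕ) : ℝ) * γ = m * γ + γ := by push_cast; ring
    rw [h1, h2]
    exact (ih (Nat.le_of_succ_le hm)).mul (hS _ hm)

theorem approxOrder_mul_resolvent_pow {E : Type*} [NormedAddCommGroup E] [InnerProductSpace ℂ E]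
    {R : E →L[ℂ] E} {W S : ℕ → E →L[ℂ] E} {γ : ℝ} {k : ℕ} (hW : ∀ i j, W (i + j) = W i * W j)
    (hRW : ∀ j ≤ k, W j * R = S j * W j) (hS : ∀ j ≤ k, ApproxOrder γ (W 1 * S j)) :
    ∀ m ≤ k, ApproxOrder (m * γ) (W m * R ^ m) := by
  intro m
  induction m with
  | zero =>
    intro _
    simpa using ApproxOrder.of_bounded (W 0)
  | succ m ih =>
    intro hm
    have h1 : W (m + 1) * R ^ (m + 1) = W 1 * S m * (W m * R ^ m) := by
      rw [pow_succ', add_comm m 1, hW, mul_assoc, ← mul_assoc (W m), hRW _ (Nat.le_of_succ_le hm)]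
      simp only [mul_assoc]
    have h2 : ((m + 1 : ℕ) : ℝ) * γ = γ + m * γ := by push_cast; ring
    rw [h1, h2]
    exact (hS _ (Nat.le_of_succ_le hm)).mul (ih (Nat.le_of_succ_le hm))

/-- The decay hypothesis lets one factor a power of the weight out of the potential. -/
theorem memLp_weight_smul_potential {V : EuclideanSpace ℝ (Fin n) → Matrix (Fin N) (Fin N) ℂ}
    (hV : ∀ l m, MemLp (fun x => V x l m) ∞ volume) {C ρ σ ε : ℝ} (hσ : 0 ≤ σ) (hσρ : σ ≤ ρ) (hε : 0 ≤ ε) (hε1 : ε ≤ 1)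
    (hdecay : ∀ l m, ∀ᵐ x : EuclideanSpace ℝ (Fin n),
      ‖V x l m‖ ≤ C * (Real.sqrt (1 + ‖x‖ ^ 2)) ^ (-ρ)) (l m : Fin N) :
    MemLp (fun x => (weight ε (σ / 2) x • V x) l m) ∞ volume := by
  refine memLp_top_of_bound ?_ C ?_
  · exact (hasTemperateGrowth_weight ε (σ / 2)).1.continuous.aestronglyMeasurable.smul (hV l m).1
  · filter_upwards [hdecay l m] with x hx
    rw [Matrix.smul_apply, norm_smul, norm_weight, norm_smul, Real.norm_of_nonneg hε]
    have h1 : (1 + (ε * ‖x‖) ^ 2) ^ (σ / 2) ≤ (Real.sqrt (1 + ‖x‖ ^ 2)) ^ ρ := by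
      have hs1 : 1 ≤ Real.sqrt (1 + ‖x‖ ^ 2) := by
        rw [Real.one_le_sqrt]
        nlinarith [sq_nonneg ‖x‖]
      calc (1 + (ε * ‖x‖) ^ 2) ^ (σ / 2) ≤ (1 + ‖x‖ ^ 2) ^ (σ / 2) := by
            gcongr
            exact mul_le_of_le_one_left (norm_nonneg x) hε1
        _ = (Real.sqrt (1 + ‖x‖ ^ 2)) ^ σ := by
            rw [Real.sqrt_eq_rpow, ← Real.rpow_mul (by positivity)]
            congr 1
            ring
        _ ≤ _ := Real.rpow_le_rpow_of_exponent_le hs1 hσρ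
    rw [Real.rpow_neg (by positivity)] at hx
    calc _ ≤ (Real.sqrt (1 + ‖x‖ ^ 2)) ^ ρ * (C * ((Real.sqrt (1 + ‖x‖ ^ 2)) ^ ρ)⁻¹) := by gcongr
      _ = C := by
        have : (Real.sqrt (1 + ‖x‖ ^ 2)) ^ ρ ≠ 0 := by positivity
        field_simp

theorem isTraceClass_pow_sub_pow (hn : 1 ≤ n) (hα : IsDiracFamily α)
    {V : EuclideanSpace ℝ (Fin n) → Matrix (Fin N) (Fin N) ℂ}
    (hV : ∀ l m, MemLp (fun x => V x l m) ∞ volume) {C ρ : ℝ} (hρ : (n : ℝ) < ρ)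
    (hdecay : ∀ l m, ∀ᵐ x : EuclideanSpace ℝ (Fin n),
      ‖V x l m‖ ≤ C * (Real.sqrt (1 + ‖x‖ ^ 2)) ^ (-ρ))
    {k : ℕ} (hk : n ≤ k) {z : ℂ} (hz : z.im ≠ 0) {R R₀ : SpinorL2 n N →L[ℂ] SpinorL2 n N}
    (hR : IsResolvent (dirac α V hV) z R) (hR₀ : IsResolvent (freeDirac α) z R₀) :
    IsTraceClass (R ^ k - R₀ ^ k) := by
  have hn0 : (1 : ℝ) ≤ n := by exact_mod_cast hn
  have hkn : (n : ℝ) ≤ k := by exact_mod_cast hk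
  -- Only the decay rate σ is used: above n for summability, below k + 1 so that each weight has
  -- exponent a < 1, where first-order regularity suffices.
  obtain ⟨σ, hnσ, hσρ, hσk⟩ : ∃ σ : ℝ, n < σ ∧ σ ≤ ρ ∧ σ < k + 1 :=
    ⟨min ρ (n + 1 / 2), lt_min hρ (by linarith), min_le_left _ _,
      (min_le_right _ _).trans_lt (by linarith)⟩
  have hk1 : (0 : ℝ) < k + 1 := by positivity
  set a : ℝ := σ / (k + 1) with ha_def
  have ha : 0 < a := div_pos (by linarith) hk1
  have ha1 : a < 1 := (div_lt_one hk1).mpr hσk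
  have hak : (k + 1) * a = σ := by rw [ha_def]; field_simp
  have hr : -(a / 2) ≤ 0 := by linarith
  -- (k + 1)γ is the midpoint of 1 and σ/n, while a/n = (σ/n)/(k + 1).
  obtain ⟨γ, hγ1, hγ2⟩ : ∃ γ : ℝ, 1 < (k + 1) * γ ∧ γ * n < a := by
    refine ⟨(1 + σ / n) / 2 / (k + 1), ?_, ?_⟩
    · have : 1 < σ / n := (one_lt_div (by linarith)).mpr hnσ
      rw [mul_div_cancel₀ _ hk1.ne']
      linarith
    · rw [ha_def, div_mul_eq_mul_div]
      gcongr
      have : σ / n * n = σ := div_mul_cancel₀ _ (by linarith)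
      linarith
  set M : ℝ := max ‖R‖ ‖R₀‖ with hM
  have hM0 : 0 ≤ M := (norm_nonneg R).trans (le_max_left _ _)
  -- The conjugation potentials with j ≤ k have norm at most (k + 1)ε, so one ε serves all Neumann
  -- series, around both `R` and `R₀`.
  obtain ⟨ε, hε, hε1, hεM⟩ : ∃ ε : ℝ, 0 < ε ∧ ε ≤ 1 ∧ (k + 1) * ε * M < 1 := by
    refine ⟨((k + 1) * (M + 1))⁻¹, by positivity, ?_, ?_⟩
    · refine inv_le_one_of_one_le₀ ?_
      nlinarith
    · rw [mul_inv, ← mul_assoc, mul_inv_cancel₀ hk1.ne', one_mul, inv_mul_eq_div,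
        div_lt_one (by linarith)]
      linarith
  have hsmall : ∀ j ≤ k, ∀ A : SpinorL2 n N →L[ℂ] SpinorL2 n N, ‖A‖ ≤ M →
      ‖weightPotentialOp hα hε.le (-(a / 2)) j‖ * ‖A‖ < 1 := by
    intro j hj A hA
    refine lt_of_le_of_lt ?_ hεM
    refine mul_le_mul ((norm_weightPotentialOp_le hα hε.le _ j).trans ?_) hA (norm_nonneg _)
      (by positivity)
    gcongr
    have h1 : |-(a / 2)| ≤ 1 := by rw [abs_neg, abs_of_pos (by linarith)]; linarith
    have h2 : (j : ℝ) ≤ k := by exact_mod_cast hj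
    calc (j : ℝ) * |-(a / 2)| ≤ j * 1 := by gcongr
      _ ≤ _ := by linarith
  -- Only j ≤ k matters; 0 fills the remaining indices so that a sequence can be chosen.
  have hleft : ∀ j, ∃ S, j ≤ k → IsResolvent ((weightPotentialOp hα hε.le (-(a / 2)) j :
      SpinorL2 n N →ₗ[ℂ] SpinorL2 n N) +ᵥ dirac α V hV) z S := fun j => by
    by_cases hj : j ≤ k
    · obtain ⟨S, hS⟩ := hR.exists_of_norm_mul_lt_one _ (hsmall j hj R (le_max_left _ _))
      exact ⟨S, fun _ => hS⟩
    · exact ⟨0, fun h => absurd h hj⟩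
  have hright : ∀ j, ∃ S, j ≤ k → IsResolvent (((-weightPotentialOp hα hε.le (-(a / 2)) j :
      SpinorL2 n N →L[ℂ] SpinorL2 n N) : SpinorL2 n N →ₗ[ℂ] SpinorL2 n N) +ᵥ freeDirac α) z S :=
    fun j => by
      by_cases hj : j ≤ k
      · obtain ⟨S, hS⟩ := hR₀.exists_of_norm_mul_lt_one (-weightPotentialOp hα hε.le (-(a / 2)) j)
          (by rw [norm_neg]; exact hsmall j hj R₀ (le_max_right _ _))
        exact ⟨S, fun _ => hS⟩
      · exact ⟨0, fun h => absurd h hj⟩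
  choose S hS using hleft
  choose S' hS' using hright
  have hL : ∀ m ≤ k, ApproxOrder (m * γ) (R ^ m * weightOp ε hr m) :=
    approxOrder_resolvent_pow_mul (weightOp_add ε hr)
      (fun j hj => mul_weightOp_eq hα hε.le hr j hV hR (hS j hj)) fun j hj => by
        have h := hS j hj
        -- B and V merge into one bounded perturbation of H₀.
        rw [dirac, ← coe_mulCLM, ← add_vadd, ← ContinuousLinearMap.toLinearMap_add] at h
        exact approxOrder_weightOp_mul_resolvent hn hα hε hε1 ha ha1 hr hγ2 hz h
  have hRt : ∀ m ≤ k, ApproxOrder (m * γ) (weightOp ε hr m * R₀ ^ m) :=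
    approxOrder_mul_resolvent_pow (weightOp_add ε hr)
      (fun j hj => weightOp_mul_eq hα hε.le hr j hR₀ (hS' j hj)) fun j hj =>
        approxOrder_weightOp_mul_resolvent hn hα hε hε1 ha ha1 hr hγ2 hz (hS' j hj)
  have hU := memLp_weight_smul_potential hV (by linarith : 0 ≤ σ) hσρ hε.le hε1 hdecay
  -- Since (k + 1)a = σ, the k + 1 decaying weights exactly cancel the growing weight contained in
  -- the bounded potential.
  have hVU : mulCLM V hV = weightOp ε hr (k + 1) * mulCLM _ hU := by
    refine (smulCLM_mul_mulCLM _ hU hV (Filter.Eventually.of_forall fun x => ?_)).symm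
    rw [smul_smul, weight_mul_weight]
    have h0 : ((k + 1 : ℕ) : ℝ) * -(a / 2) + σ / 2 = 0 := by
      push_cast
      linarith
    rw [h0]
    simp [weight]
  have hR1 : IsResolvent ((mulCLM V hV : SpinorL2 n N →ₗ[ℂ] SpinorL2 n N) +ᵥ freeDirac α) z R := hR
  rw [hR₀.pow_sub_pow hR1 k]
  refine ApproxOrder.isTraceClass hγ1 (ApproxOrder.sum _ fun j hj => ?_)
  have hjk := Finset.mem_range.mp hj
  -- Of the k + 1 weights, j + 1 go left and k - j go right, matching the number of resolvents on
  -- each side.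
  have hfac : R ^ (j + 1) * -mulCLM V hV * R₀ ^ (k - j) =
      R ^ (j + 1) * weightOp ε hr (j + 1) * -mulCLM _ hU *
        (weightOp ε hr (k - j) * R₀ ^ (k - j)) := by
    have h1 : mulCLM V hV = weightOp ε hr (j + 1) * mulCLM _ hU * weightOp ε hr (k - j) := by
      have h2 : k + 1 = (j + 1) + (k - j) := by omega
      have h3 : (weightOp ε hr (k - j) : SpinorL2 n N →L[ℂ] SpinorL2 n N) * mulCLM _ hU =
          mulCLM _ hU * weightOp ε hr (k - j) := smulCLM_mulCLM_comm _ hU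
      rw [hVU, h2, weightOp_add, mul_assoc, h3, mul_assoc]
    rw [h1]
    simp only [mul_assoc, mul_neg, neg_mul]
  rw [hfac]
  have h4 : ((k : ℝ) + 1) * γ = ((j + 1 : ℕ) : ℝ) * γ + ((k - j : ℕ) : ℝ) * γ := by
    rw [Nat.cast_sub hjk.le]
    push_cast
    ring
  rw [h4]
  exact ((hL (j + 1) hjk).mul_bounded _).mul (hRt (k - j) (Nat.sub_le k j))

end Main

theorem theoremt7p4 (n : ℕ) (hn : 1 ≤ n)
    (α : Fin (n + 1) → Matrix (Fin (spinorDim n)) (Fin (spinorDim n)) ℂ) (hα : IsDiracFamily α)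
    (V : EuclideanSpace ℝ (Fin n) → Matrix (Fin (spinorDim n)) (Fin (spinorDim n)) ℂ)
    (hV : ∀ l m, MemLp (fun x => V x l m) ∞ volume)
    (C ρ : ℝ) (hC : 0 < C) (hρ : (n : ℝ) < ρ)
    (hdecay : ∀ l m, ∀ᵐ x : EuclideanSpace ℝ (Fin n),
      ‖V x l m‖ ≤ C * (Real.sqrt (1 + ‖x‖ ^ 2)) ^ (-ρ))
    (k : ℕ) (hk : n ≤ k) (z : ℂ) (hz : z.im ≠ 0) :
    z ∈ pmapResolventSet (freeDirac α) ∧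
    ((∀ᵐ x : EuclideanSpace ℝ (Fin n), (V x).IsHermitian) →
      z ∈ pmapResolventSet (dirac α V hV)) ∧
    (∀ R R₀ : SpinorL2 n (spinorDim n) →L[ℂ] SpinorL2 n (spinorDim n),
      IsResolvent (dirac α V hV) z R → IsResolvent (freeDirac α) z R₀ →
        IsTraceClass (R ^ k - R₀ ^ k)) := by
  refine ⟨⟨freeResolvent hα hz, isResolvent_freeResolvent hα hz⟩, fun hVh => ?_,
    fun R R₀ hR hR₀ => isTraceClass_pow_sub_pow hn hα hV hρ hdecay hk hz hR hR₀⟩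
  exact exists_isResolvent_of_symmetric hz (inner_freeDirac_im hα)
    (isResolvent_freeResolvent hα hz) (mulCLM V hV) (inner_mulCLM_im hV hVh)
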